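/- Let $\mathcal A$ be a von Neumann algebra on a complex Hilbert space, with a finite trace $\tau$, i.e. a positive linear functional $\tau:\mathcal A\to\mathbb C$ with $\tau(AB)=\tau(BA)$. Let $\mathcal A_0=\{A\in\mathcal A: 0\notin \operatorname{conv}\sigma(A)\}$. For $A\in\mathcal A_0$ put $$\textstyle\det_\tau(A)=\exp\circ\,\tau\Bigl(\frac1{2\pi i}\int_\Gamma \log\lambda\,(\lambda-A)^{-1}\,d\lambda\Bigr),$$ where $\Gamma$ is the positively oriented (piecewise $C^1$) boundary of a bounded, connected, simply connected region $\Omega\supseteq\operatorname{conv}\sigma(A)$ and $\log$ is a branch of the logarithm on an open set containing $\Omega\cup\Gamma$. Positive orientation means that $\Gamma$ has index $1$ about the points of $\Omega$ and index $0$ about the points outside $\overline\Omega$. In general $\det_\tau(A)$ is multi-valued: it denotes the set of all values obtained from all choices of $\Omega$, $\Gamma$ and $\log$. Likewise, $z^{\tau(I)}$ denotes the set $\{e^{\tau(I)w}: e^w=z\}$, and a product of such sets is the set of all products of their elements. For $A$ invertible let $\mathrm{Det}(A)=\exp\tau(\log\sqrt{A^*A})$ be the Fuglede–Kadison determinant ($\sqrt{\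 }$ and the real logarithm being taken by the continuous functional calculus), and let the polar decomposition of $A$ be $A=UH$ with $U$ unitary and $H=\sqrt{A^*A}$. Let $A\in\mathcal A_0$. Then $\det_\tau(A)$ is non-empty, and for each $d\in\det_\tau(A)$ we have $\det_\tau(A)=\{e^{2\pi i n\tau(I)}d : n\in\mathbb Z\}$. Moreover: (i) for every $z\in\mathbb C\setminus\{0\}$, $zA\in\mathcal A_0$ and $\det_\tau(zA)=z^{\tau(I)}\det_\tau(A)$; (ii) if $A$ is normal, then $A$ has a polar decomposition in $\mathcal A$, and for every polar decomposition $A=UH$ with $U,H\in\mathcal A$ we have $U,H\in\mathcal A_0$ and $\det_\tau(A)=\det_\tau(U)\det_\tau(H)$; (iii) if $A$ is positive, then $\mathrm{Det}(A)\in\det_\tau(A)$, and $\mathrm{Det}(A)$ is the value given by every choice for which $\log$ is real on $\sigma(A)$. If $\tau(I)\in\mathbb Z$ (for instance if $\tau$ is normalized), then $\det_\tau(A)$ is a single number for each $A\in\mathcal A_0$, and $\det_\tau(zA)=z^{\tau(I)}\det_\tau(A)$ for $z\neq0$; $\det_\tau(A)=\det_\tau(U)\det_\tau(H)$ if $A$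 is normal with polar decomposition $A=UH$; and $\det_\tau(A)=\mathrm{Det}(A)$ if $A$ is positive. These are identities between numbers. -/

import Mathlib

open scoped Pointwise ComplexOrder

noncomputable section

/-! ### Von Neumann algebras as C⋆-algebras -/

instance VonNeumannAlgebra.instSMulMemClass {H : Type*} [NormedAddCommGroup H]
    [InnerProductSpace ℂ H] [CompleteSpace H] :
    SMulMemClass (VonNeumannAlgebra H) ℂ (H →L[ℂ] H) where
  smul_mem {S} r _ hx := S.toStarSubalgebra.smul_mem hx r

theorem VonNeumannAlgebra.isClosed_coe {H : Type*} [NormedAddCommGroup H]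
    [InnerProductSpace ℂ H] [CompleteSpace H] (S : VonNeumannAlgebra H) :
    IsClosed (S : Set (H →L[ℂ] H)) := by
  rw [← S.centralizer_centralizer]
  exact Set.isClosed_centralizer _

/-- A von Neumann algebra with the operations, adjoint and operator norm inherited from `B(H)`. -/
instance VonNeumannAlgebra.instCStarAlgebra {H : Type*} [NormedAddCommGroup H]
    [InnerProductSpace ℂ H] [CompleteSpace H] (S : VonNeumannAlgebra H) : CStarAlgebra S :=
  StarSubalgebra.cstarAlgebra S (h_closed := S.isClosed_coe)

/-- A finite trace: a positive (everywhere defined) linear functional with `τ(ab) = τ(ba)`. -/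
structure IsFiniteTrace {M : Type*} [CStarAlgebra M] (τ : M →ₗ[ℂ] ℂ) : Prop where
  nonneg : ∀ a : M, 0 ≤ τ (star a * a)
  tracial : ∀ a b : M, τ (a * b) = τ (b * a)

/-! ### Contours -/

/-- The integral `∫_γ f(λ) dλ` of `f` along the curve `γ`, parametrised by `[0, 1]`. -/
def contourIntegral {E : Type*} [NormedAddCommGroup E] [NormedSpace ℂ E]
    (γ : ℝ → ℂ) (f : ℂ → E) : E :=
  ∫ s in (0 : ℝ)..1, deriv γ s • f (γ s)

/-- The index (winding number) of the closed curve `γ` about `w`. -/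
def contourIndex (γ : ℝ → ℂ) (w : ℂ) : ℂ :=
  (2 * Real.pi * Complex.I)⁻¹ * contourIntegral γ (fun l => (l - w)⁻¹)

/-- `γ`, restricted to `[0, 1]`, is a closed piecewise `C¹` curve. -/
structure IsClosedPiecewiseC1 (γ : ℝ → ℂ) : Prop where
  closed : γ 0 = γ 1
  piecewise : ∃ (n : ℕ) (t : ℕ → ℝ), Monotone t ∧ t 0 = 0 ∧ t n = 1 ∧
    ∀ i < n, ContDiffOn ℝ 1 γ (Set.Icc (t i) (t (i + 1)))

/-- The closed curve `γ` is the positively oriented boundary of `Ω`. -/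
structure IsOrientedBoundary (γ : ℝ → ℂ) (Ω : Set ℂ) : Prop where
  curve : IsClosedPiecewiseC1 γ
  image_eq : γ '' Set.Icc 0 1 = frontier Ω
  index_inside : ∀ w ∈ Ω, contourIndex γ w = 1
  index_outside : ∀ w, w ∉ closure Ω → contourIndex γ w = 0

/-- The choices that enter the logarithm of an operator: a bounded, connected, simply connected
region `Ω ⊇ K`, its positively oriented boundary curve `γ`, and a branch `log` of the logarithm
on an open set `D` that contains `Ω` together with its boundary. -/
structure LogContour (K : Set ℂ) where
  Ω : Set ℂ
  γ : ℝ → ℂ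
  D : Set ℂ
  log : ℂ → ℂ
  isOpen_region : IsOpen Ω
  isBounded_region : Bornology.IsBounded Ω
  isConnected_region : IsConnected Ω
  isSimplyConnected_region : IsSimplyConnected Ω
  subset_region : K ⊆ Ω
  boundary : IsOrientedBoundary γ Ω
  isOpen_domain : IsOpen D
  closure_subset_domain : closure Ω ⊆ D
  continuousOn_log : ContinuousOn log D
  exp_log : ∀ l ∈ D, Complex.exp (log l) = l

/-! ### The analytic determinant -/

section Determinant

variable {M : Type*} [CStarAlgebra M]

/-- The set `𝒜₀` of all elements such that `0` is not in the convex hull of the spectrum. -/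
def analyticDomain (M : Type*) [CStarAlgebra M] : Set M :=
  {A | (0 : ℂ) ∉ convexHull ℝ (spectrum ℂ A)}

/-- `log A = (1 / 2πi) ∫_γ log λ (λ - A)⁻¹ dλ`. -/
def contourLog (A : M) (c : LogContour (convexHull ℝ (spectrum ℂ A))) : M :=
  (2 * Real.pi * Complex.I)⁻¹ • contourIntegral c.γ (fun l => c.log l • resolvent A l)

/-- The determination `exp τ(log A)` of the determinant of `A` given by the choice `c`. -/
def contourDet (τ : M →ₗ[ℂ] ℂ) (A : M) (c : LogContour (convexHull ℝ (spectrum ℂ A))) : ℂ :=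
  Complex.exp (τ (contourLog A c))

/-- The set of all determinations of `det_τ(A)`, over all regions, contours and branches. -/
def detValues (τ : M →ₗ[ℂ] ℂ) (A : M) : Set ℂ :=
  Set.range (contourDet τ A)

open Classical in
/-- `det_τ(A)` as a number: one of its determinations (the only one if `τ(I)` is an integer). -/
def analyticDet (τ : M →ₗ[ℂ] ℂ) (A : M) : ℂ :=
  if h : (detValues τ A).Nonempty then h.some else 0

/-- The Fuglede–Kadison determinant `exp τ(log |A|)`, `|A| = √(A⋆A)`, of an invertible `A`,
where `√` and `log` are given by the continuous functional calculus. -/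
def fugledeKadisonDet (τ : M →ₗ[ℂ] ℂ) (A : M) : ℂ :=
  Complex.exp (τ (cfc Real.log (cfc Real.sqrt (star A * A))))

end Determinant

/-- The set of all determinations of the power `z ^ s`: all `exp(s w)` with `exp w = z`. -/
def cpowValues (z s : ℂ) : Set ℂ :=
  {v | ∃ w : ℂ, Complex.exp w = z ∧ v = Complex.exp (s * w)}

/-- `T = U P` is the polar decomposition of the invertible operator `T`:
`U` is unitary and `P = √(T⋆T)`, the positive square root. -/
structure IsPolarDecomposition {H : Type*} [NormedAddCommGroup H] [InnerProductSpace ℂ H]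
    [CompleteSpace H] (T U P : H →L[ℂ] H) : Prop where
  eq_mul : T = U * P
  unitary : U ∈ unitary (H →L[ℂ] H)
  positive : P.IsPositive
  sq_eq : P * P = star T * T

end

/-! Everything rests on `contourLog_eq`: for any a in conv σ(A), log A = log a · 1 + ∫₀¹ (A − a)(a +
t(A − a))⁻¹ dt, where the integral involves neither the contour nor the branch. The elements B_t = a
+ t(A − a) have spectrum in conv σ(A), hence off the contour and away from 0. Differentiating ∫ log
λ (λ − B_t)⁻¹ dλ in t gives (A − a) ∫ log λ (λ − B_t)⁻² dλ, which by parts is (A − a) ∫ λ⁻¹ (λ −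
B_t)⁻¹ dλ. As 0 lies outside the contour, ∫ λ⁻¹ dλ = 0, so this equals (A − a) B_t⁻¹ ∫ (λ − B_t)⁻¹
dλ, and the last integral is constant in t with value 2πi.

The starting value at a is Cauchy's formula for the logarithm, `LogContour.cauchyLog_of_mem`, which
is derived from the index conditions alone. The contour integral of the difference quotient of log
based at a is constant for a in Ω, vanishes on a ray outside the closure, and has a common limit
from both sides at a boundary point of largest modulus.

The claims follow. The integrand is unchanged when A, a become zA, za, so logarithms of A and zA
differ by w · 1 with e^w = z; the case z = 1, together with adding constants to a branch, gives the
orbit. For normal A the formula identifies the contour integral with the continuous functional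
calculus (`contourLog_eq_cfc`). Since U and H are the functions z/|z| and |z| of A, a branch on a
half-plane containing σ(A) and σ(U) gives log A = log U + log H. For positive A a branch that is
real on σ(A) is `Real.log` there. Contours exist because Hahn–Banach puts σ(A) in an open
half-plane, and a disc in that half-plane contains conv σ(A). -/

noncomputable section

open MeasureTheory Set Filter Topology

/-! ### Integration along piecewise C¹ curves -/

section Curve

variable {γ : ℝ → ℂ} {E : Type*} [NormedAddCommGroup E] [NormedSpace ℂ E]

/-- Induction along a subdivision: a property of intervals that holds on each piece and is stable
under concatenation holds on the whole interval. -/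
theorem subdivision_induction {t : ℕ → ℝ} {P : ℝ → ℝ → Prop} {n : ℕ}
    (hrefl : P (t 0) (t 0)) (hpiece : ∀ i < n, P (t i) (t (i + 1)))
    (htrans : ∀ i < n, P (t 0) (t i) → P (t i) (t (i + 1)) → P (t 0) (t (i + 1))) :
    P (t 0) (t n) := by
  have h : ∀ k ≤ n, P (t 0) (t k) := by
    intro k
    induction k with
    | zero => exact fun _ => hrefl
    | succ k ih => exact fun hk => htrans k hk (ih (by omega)) (hpiece k hk)
  exact h n le_rfl

theorem IsClosedPiecewiseC1.continuousOn (hγ : IsClosedPiecewiseC1 γ) :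
    ContinuousOn γ (Icc 0 1) := by
  obtain ⟨n, t, ht, h0, h1, h⟩ := hγ.piecewise
  rw [← h0, ← h1]
  refine subdivision_induction (t := t) (P := fun a b => ContinuousOn γ (Icc a b)) (by simp)
    (fun i hi => (h i hi).continuousOn) fun i hi ha hb => ?_
  rw [← Icc_union_Icc_eq_Icc (ht (Nat.zero_le i)) (ht (Nat.le_succ i))]
  exact ha.union_of_isClosed hb isClosed_Icc isClosed_Icc

theorem ContDiffOn.intervalIntegrable_deriv {a b : ℝ} (hab : a ≤ b)
    (h : ContDiffOn ℝ 1 γ (Icc a b)) : IntervalIntegrable (deriv γ) volume a b := by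
  rcases hab.eq_or_lt with rfl | hlt
  · simp
  have hc : ContinuousOn (derivWithin γ (Icc a b)) (Icc a b) :=
    h.continuousOn_derivWithin (uniqueDiffOn_Icc hlt) le_rfl
  have hi : IntervalIntegrable (derivWithin γ (Icc a b)) volume a b :=
    hc.intervalIntegrable_of_Icc hab
  refine hi.congr_ae ?_
  -- At the endpoints `deriv γ` need not agree with the one-sided derivative; they form a null set
  -- and are dropped.
  rw [uIoc_of_le hab, ← restrict_Ioo_eq_restrict_Ioc]
  refine ae_restrict_of_forall_mem measurableSet_Ioo fun x hx => ?_
  exact derivWithin_of_mem_nhds (Icc_mem_nhds hx.1 hx.2)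

theorem IsClosedPiecewiseC1.intervalIntegrable_deriv (hγ : IsClosedPiecewiseC1 γ) :
    IntervalIntegrable (deriv γ) volume 0 1 := by
  obtain ⟨n, t, ht, h0, h1, h⟩ := hγ.piecewise
  rw [← h0, ← h1]
  exact subdivision_induction (t := t)
    (P := fun a b => IntervalIntegrable (deriv γ) volume a b) (by simp)
    (fun i hi => (h i hi).intervalIntegrable_deriv (ht (Nat.le_succ i)))
    fun i _ ha hb => ha.trans hb

theorem IsClosedPiecewiseC1.exists_countable_hasDerivAt (hγ : IsClosedPiecewiseC1 γ) :
    ∃ S : Set ℝ, S.Countable ∧ ∀ x ∈ Ioo (0 : ℝ) 1 \ S, HasDerivAt γ (deriv γ x) x := by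
  obtain ⟨n, t, ht, h0, h1, h⟩ := hγ.piecewise
  refine ⟨range t, countable_range t, ?_⟩
  rw [← h0, ← h1]
  refine subdivision_induction (t := t)
    (P := fun a b => ∀ x ∈ Ioo a b \ range t, HasDerivAt γ (deriv γ x) x) (by simp) ?_ ?_
  · intro i hi x hx
    exact (((h i hi).contDiffAt (Icc_mem_nhds hx.1.1 hx.1.2)).differentiableAt
      one_ne_zero).hasDerivAt
  · intro i _ ha hb x hx
    rcases lt_trichotomy x (t i) with hlt | heq | hgt
    · exact ha x ⟨⟨hx.1.1, hlt⟩, hx.2⟩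
    · exact absurd ⟨i, heq.symm⟩ hx.2
    · exact hb x ⟨⟨hgt, hx.1.2⟩, hx.2⟩

theorem IsClosedPiecewiseC1.isCompact_image (hγ : IsClosedPiecewiseC1 γ) :
    IsCompact (γ '' Icc 0 1) :=
  isCompact_Icc.image_of_continuousOn hγ.continuousOn

theorem IsClosedPiecewiseC1.intervalIntegrable_smul (hγ : IsClosedPiecewiseC1 γ) {g : ℂ → E}
    (hg : ContinuousOn g (γ '' Icc 0 1)) :
    IntervalIntegrable (fun s => deriv γ s • g (γ s)) volume 0 1 := by
  refine hγ.intervalIntegrable_deriv.smul_continuousOn ?_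
  rw [uIcc_of_le zero_le_one]
  exact hg.comp hγ.continuousOn (mapsTo_image _ _)

theorem contourIntegral_congr {f g : ℂ → E} (h : EqOn f g (γ '' Icc 0 1)) :
    contourIntegral γ f = contourIntegral γ g := by
  refine intervalIntegral.integral_congr fun s hs => ?_
  rw [uIcc_of_le zero_le_one] at hs
  simp only [h (mem_image_of_mem γ hs)]

theorem contourIntegral_const_mul {R : Type*} [NormedRing R] [NormedAlgebra ℂ R] [CompleteSpace R]
    (hγ : IsClosedPiecewiseC1 γ) (a : R) {f : ℂ → R} (hf : ContinuousOn f (γ '' Icc 0 1)) :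
    contourIntegral γ (fun l => a * f l) = a * contourIntegral γ f := by
  have := (ContinuousLinearMap.mul ℂ R a).intervalIntegral_comp_comm
    (hγ.intervalIntegrable_smul hf)
  simpa [contourIntegral] using this

theorem contourIntegral_smul_const [CompleteSpace E] (f : ℂ → ℂ) (x : E) :
    contourIntegral γ (fun l => f l • x) = contourIntegral γ f • x := by
  simp only [contourIntegral, ← smul_assoc]
  exact intervalIntegral.integral_smul_const _ _

theorem contourIntegral_sub (hγ : IsClosedPiecewiseC1 γ) {f g : ℂ → E}
    (hf : ContinuousOn f (γ '' Icc 0 1)) (hg : ContinuousOn g (γ '' Icc 0 1)) :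
    contourIntegral γ (fun l => f l - g l) = contourIntegral γ f - contourIntegral γ g := by
  simp only [contourIntegral, smul_sub]
  exact intervalIntegral.integral_sub (hγ.intervalIntegrable_smul hf)
    (hγ.intervalIntegrable_smul hg)

/-- A continuous function with a primitive has integral zero along a closed curve. -/
theorem contourIntegral_eq_zero_of_hasDerivAt [CompleteSpace E] (hγ : IsClosedPiecewiseC1 γ)
    {F F' : ℂ → E} (hF : ∀ z ∈ γ '' Icc 0 1, HasDerivAt F (F' z) z)
    (hF' : ContinuousOn F' (γ '' Icc 0 1)) : contourIntegral γ F' = 0 := by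
  obtain ⟨S, hS, hd⟩ := hγ.exists_countable_hasDerivAt
  have hc : ContinuousOn (F ∘ γ) (Icc 0 1) := by
    refine ContinuousOn.comp (t := γ '' Icc 0 1) ?_ hγ.continuousOn (mapsTo_image _ _)
    exact fun z hz => (hF z hz).continuousAt.continuousWithinAt
  rw [contourIntegral, integral_eq_of_hasDerivAt_off_countable_of_le (F ∘ γ) _ zero_le_one
    hS hc (fun x hx => (hF (γ x) ⟨x, Ioo_subset_Icc_self hx.1, rfl⟩).scomp x (hd x hx))
    (hγ.intervalIntegrable_smul hF')]
  simp [hγ.closed]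

/-- Fubini's theorem for a contour integral and an interval integral. -/
theorem contourIntegral_intervalIntegral_swap (hγ : IsClosedPiecewiseC1 γ)
    {g : ℂ → ℝ → E} (hg : ContinuousOn (Function.uncurry g) ((γ '' Icc 0 1) ×ˢ Icc 0 1)) :
    contourIntegral γ (fun l => ∫ t in (0 : ℝ)..1, g l t) =
      ∫ t in (0 : ℝ)..1, contourIntegral γ (fun l => g l t) := by
  have hc : ContinuousOn (fun p : ℝ × ℝ => g (γ p.1) p.2) (Icc 0 1 ×ˢ Icc 0 1) := by
    refine hg.comp (f := fun p : ℝ × ℝ => (γ p.1, p.2)) ?_ ?_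
    · exact (hγ.continuousOn.comp continuousOn_fst fun p hp => hp.1).prodMk continuousOn_snd
    · exact fun p hp => ⟨mem_image_of_mem γ hp.1, hp.2⟩
  obtain ⟨C, hC⟩ := (isCompact_Icc.prod isCompact_Icc).exists_bound_of_continuousOn hc
  simp only [contourIntegral, intervalIntegral.integral_of_le zero_le_one]
  simp only [← integral_smul]
  refine integral_integral_swap ?_
  have hsub : Ioc (0 : ℝ) 1 ×ˢ Ioc (0 : ℝ) 1 ⊆ Icc 0 1 ×ˢ Icc 0 1 :=
    prod_mono Ioc_subset_Icc_self Ioc_subset_Icc_self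
  have hd : Integrable (fun p : ℝ × ℝ => deriv γ p.1)
      ((volume.restrict (Ioc 0 1)).prod (volume.restrict (Ioc 0 1))) := by
    have := hγ.intervalIntegrable_deriv.1
    exact Integrable.comp_fst this _
  refine hd.smul_bdd C ?_ ?_
  · rw [Measure.prod_restrict]
    exact (hc.mono hsub).aestronglyMeasurable (measurableSet_Ioc.prod measurableSet_Ioc)
  · rw [Measure.prod_restrict]
    exact ae_restrict_of_forall_mem (measurableSet_Ioc.prod measurableSet_Ioc)
      fun p hp => hC p (hsub hp)

end Curve

/-! ### Contour integrals of resolvents along segments of commuting elements -/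

section Resolvent

variable {γ : ℝ → ℂ} {M : Type*} [NormedRing M] [NormedAlgebra ℂ M] [CompleteSpace M]

theorem continuousAt_resolvent_uncurry {a : M} {l : ℂ} (h : l ∈ resolventSet ℂ a) :
    ContinuousAt (fun p : ℂ × M => resolvent p.2 p.1) (l, a) := by
  have h1 : ContinuousAt Ring.inverse (algebraMap ℂ M l - a) := by
    obtain ⟨u, hu⟩ : IsUnit (algebraMap ℂ M l - a) := h
    exact hu ▸ NormedRing.inverse_continuousAt u
  refine ContinuousAt.comp (f := fun p : ℂ × M => algebraMap ℂ M p.1 - p.2) h1 ?_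
  have := continuous_algebraMap ℂ M
  fun_prop

theorem hasDerivAt_resolvent_line {A B : M} {l : ℂ} {t : ℝ}
    (h : l ∈ resolventSet ℂ (B + (t : ℂ) • (A - B))) :
    HasDerivAt (fun t : ℝ => resolvent (B + (t : ℂ) • (A - B)) l)
      (resolvent (B + (t : ℂ) • (A - B)) l * (A - B) * resolvent (B + (t : ℂ) • (A - B)) l) t := by
  obtain ⟨u, hu⟩ : IsUnit (algebraMap ℂ M l - (B + (t : ℂ) • (A - B))) := h
  have h1 := hasFDerivAt_ringInverse (𝕜 := ℝ) u
  rw [hu] at h1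
  have h2 : HasDerivAt (fun t : ℝ => algebraMap ℂ M l - (B + (t : ℂ) • (A - B))) (-(A - B)) t := by
    have h3 : HasDerivAt (fun t : ℝ => (t : ℂ) • (A - B)) ((1 : ℂ) • (A - B)) t :=
      (Complex.ofRealCLM.hasDerivAt (x := t)).smul_const (A - B)
    simpa using (h3.const_add B).const_sub (algebraMap ℂ M l)
  have h4 := h1.comp_hasDerivAt t h2
  have h5 : resolvent (B + (t : ℂ) • (A - B)) l = ↑u⁻¹ := by
    rw [resolvent, ← Ring.inverse_unit u, hu]
  rw [h5]
  refine h4.congr_deriv ?_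
  rw [neg_apply, ContinuousLinearMap.mulLeftRight_apply, mul_neg, neg_mul,
    neg_neg]

theorem continuousOn_resolvent_line {S : Set ℂ} {A B : M}
    (hu : ∀ t ∈ Icc (0 : ℝ) 1, ∀ l ∈ S, l ∈ resolventSet ℂ (B + (t : ℂ) • (A - B))) :
    ContinuousOn (fun p : ℂ × ℝ => resolvent (B + (p.2 : ℂ) • (A - B)) p.1) (S ×ˢ Icc 0 1) := by
  intro p hp
  refine ContinuousAt.continuousWithinAt ?_
  refine ContinuousAt.comp (g := fun p : ℂ × M => resolvent p.2 p.1)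
    (f := fun p : ℂ × ℝ => (p.1, B + (p.2 : ℂ) • (A - B)))
    (continuousAt_resolvent_uncurry (hu p.2 hp.2 p.1 hp.1)) ?_
  fun_prop

/-- Integration by parts for the resolvent. -/
theorem contourIntegral_smul_resolvent_sq (hγ : IsClosedPiecewiseC1 γ) {f f' : ℂ → ℂ}
    (hf : ∀ z ∈ γ '' Icc 0 1, HasDerivAt f (f' z) z) (hf' : ContinuousOn f' (γ '' Icc 0 1))
    {A : M} (hu : γ '' Icc 0 1 ⊆ resolventSet ℂ A) :
    contourIntegral γ (fun l => f l • resolvent A l ^ 2) =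
      contourIntegral γ (fun l => f' l • resolvent A l) := by
  have hR : ContinuousOn (resolvent A) (γ '' Icc 0 1) := fun z hz =>
    (spectrum.hasDerivAt_resolvent_const_left (hu hz)).continuousAt.continuousWithinAt
  have hfc : ContinuousOn f (γ '' Icc 0 1) := fun z hz =>
    (hf z hz).continuousAt.continuousWithinAt
  have h1 := hf'.fun_smul hR
  have h2 := hfc.fun_smul (hR.fun_pow 2)
  -- The derivative of the resolvent in λ is minus its square, so the product rule exhibits the
  -- difference of the two integrands as an exact derivative.
  have h := contourIntegral_eq_zero_of_hasDerivAt hγ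
    (F := fun l => f l • resolvent A l)
    (F' := fun l => f' l • resolvent A l - f l • resolvent A l ^ 2) (fun z hz => by
      have := (hf z hz).smul (spectrum.hasDerivAt_resolvent_const_left (hu hz))
      refine this.congr_deriv ?_
      rw [smul_neg, neg_add_eq_sub]) (h1.fun_sub h2)
  rw [contourIntegral_sub hγ h1 h2, sub_eq_zero] at h
  exact h.symm

/-- The change of a contour integral of the resolvent along a segment of commuting elements. -/
theorem contourIntegral_smul_resolvent_sub (hγ : IsClosedPiecewiseC1 γ) {f f' : ℂ → ℂ}
    (hf : ∀ z ∈ γ '' Icc 0 1, HasDerivAt f (f' z) z) (hf' : ContinuousOn f' (γ '' Icc 0 1))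
    {A B : M} (hAB : Commute A B)
    (hu : ∀ t ∈ Icc (0 : ℝ) 1, ∀ l ∈ γ '' Icc 0 1, l ∈ resolventSet ℂ (B + (t : ℂ) • (A - B))) :
    contourIntegral γ (fun l => f l • resolvent A l) -
      contourIntegral γ (fun l => f l • resolvent B l) =
      ∫ t in (0 : ℝ)..1, (A - B) *
        contourIntegral γ (fun l => f' l • resolvent (B + (t : ℂ) • (A - B)) l) := by
  have hfc : ContinuousOn f (γ '' Icc 0 1) := fun z hz =>
    (hf z hz).continuousAt.continuousWithinAt
  have hRc : ∀ t ∈ Icc (0 : ℝ) 1,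
      ContinuousOn (resolvent (B + (t : ℂ) • (A - B))) (γ '' Icc 0 1) := fun t ht z hz =>
    (spectrum.hasDerivAt_resolvent_const_left (hu t ht z hz)).continuousAt.continuousWithinAt
  have hcont := continuousOn_resolvent_line hu
  have hB := hRc 0 (by simp)
  have hA := hRc 1 (by simp)
  simp only [Complex.ofReal_zero, zero_smul, add_zero] at hB
  simp only [Complex.ofReal_one, one_smul, add_sub_cancel] at hA
  -- Commutation turns the t-derivative R(A − B)R into (A − B)R², so that the integration by parts
  -- in λ applies.
  have hcomm : ∀ t ∈ Icc (0 : ℝ) 1, ∀ l ∈ γ '' Icc 0 1,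
      Commute (A - B) (resolvent (B + (t : ℂ) • (A - B)) l) := by
    intro t ht l hl
    obtain ⟨u, hu'⟩ : IsUnit (algebraMap ℂ M l - (B + (t : ℂ) • (A - B))) := hu t ht l hl
    rw [resolvent, ← hu', Ring.inverse_unit]
    refine Commute.units_inv_right ?_
    rw [hu']
    have hb : Commute (A - B) B := hAB.sub_left (Commute.refl B)
    exact (Algebra.commute_algebraMap_right l (A - B)).sub_right
      (hb.add_right ((Commute.refl _).smul_right _))
  rw [← contourIntegral_sub hγ (hfc.fun_smul hA) (hfc.fun_smul hB)]
  -- The fundamental theorem of calculus in t for fixed λ; Fubini then moves the contour integral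
  -- inside.
  have hstep : ∀ l ∈ γ '' Icc 0 1, f l • resolvent A l - f l • resolvent B l =
      ∫ t in (0 : ℝ)..1, f l • ((A - B) * resolvent (B + (t : ℂ) • (A - B)) l ^ 2) := by
    intro l hl
    have hl2 : ContinuousOn (fun t : ℝ => resolvent (B + (t : ℂ) • (A - B)) l) (Icc 0 1) :=
      hcont.comp (f := fun t : ℝ => (l, t)) (by fun_prop) fun t ht => ⟨hl, ht⟩
    have h := intervalIntegral.integral_eq_sub_of_hasDerivAt
      (f := fun t : ℝ => resolvent (B + (t : ℂ) • (A - B)) l) (a := 0) (b := 1)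
      (f' := fun t : ℝ => (A - B) * resolvent (B + (t : ℂ) • (A - B)) l ^ 2) (fun t ht => by
        rw [uIcc_of_le zero_le_one] at ht
        refine (hasDerivAt_resolvent_line (hu t ht l hl)).congr_deriv ?_
        rw [← (hcomm t ht l hl).eq, sq, mul_assoc])
      ((continuousOn_const.mul (hl2.pow 2)).intervalIntegrable_of_Icc zero_le_one)
    rw [intervalIntegral.integral_smul, h]
    simp [smul_sub]
  rw [contourIntegral_congr hstep, contourIntegral_intervalIntegral_swap hγ]
  · refine intervalIntegral.integral_congr fun t ht => ?_
    rw [uIcc_of_le zero_le_one] at ht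
    rw [← contourIntegral_smul_resolvent_sq hγ hf hf' (fun l hl => hu t ht l hl),
      ← contourIntegral_const_mul hγ _ (hfc.fun_smul ((hRc t ht).fun_pow 2))]
    simp only [mul_smul_comm]
  · exact (hfc.comp continuousOn_fst fun p hp => hp.1).smul
      (continuousOn_const.mul (hcont.pow 2))

/-- The contour integral of the resolvent is constant along a segment of commuting elements. -/
theorem contourIntegral_resolvent_eq (hγ : IsClosedPiecewiseC1 γ) {A B : M} (hAB : Commute A B)
    (hu : ∀ t ∈ Icc (0 : ℝ) 1, ∀ l ∈ γ '' Icc 0 1, l ∈ resolventSet ℂ (B + (t : ℂ) • (A - B))) :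
    contourIntegral γ (resolvent A) = contourIntegral γ (resolvent B) := by
  have h := contourIntegral_smul_resolvent_sub hγ (f := fun _ => 1) (f' := fun _ => 0)
    (fun z _ => hasDerivAt_const z (1 : ℂ)) continuousOn_const hAB hu
  rw [← sub_eq_zero]
  simpa [contourIntegral] using h

end Resolvent

/-! ### Difference quotients and their limits at the contour -/

section DifferenceQuotient

variable {γ : ℝ → ℂ}

/-- Dominated convergence with the majorant C |γ′|, which is integrable although γ′ may jump. -/
theorem tendsto_contourIntegral {ι : Type*} {F : Filter ι} [F.IsCountablyGenerated]
    (hγ : IsClosedPiecewiseC1 γ) {f : ι → ℂ → ℂ} {g : ℂ → ℂ} {C : ℝ}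
    (hf : ∀ᶠ i in F, ContinuousOn (f i) (γ '' Icc 0 1))
    (hC : ∀ᶠ i in F, ∀ z ∈ γ '' Icc 0 1, ‖f i z‖ ≤ C)
    (hg : ∀ z ∈ γ '' Icc 0 1, Tendsto (fun i => f i z) F (𝓝 (g z))) :
    Tendsto (fun i => contourIntegral γ (f i)) F (𝓝 (contourIntegral γ g)) := by
  have hmem : ∀ s ∈ uIoc (0 : ℝ) 1, γ s ∈ γ '' Icc 0 1 := fun s hs => by
    rw [uIoc_of_le zero_le_one] at hs
    exact mem_image_of_mem γ (Ioc_subset_Icc_self hs)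
  refine intervalIntegral.tendsto_integral_filter_of_dominated_convergence
    (fun s => ‖deriv γ s‖ * C) ?_ ?_ ?_ ?_
  · filter_upwards [hf] with i hi
    rw [uIoc_of_le zero_le_one]
    exact (hγ.intervalIntegrable_smul hi).1.aestronglyMeasurable
  · filter_upwards [hC] with i hi
    refine ae_of_all _ fun s hs => ?_
    rw [norm_smul]
    exact mul_le_mul_of_nonneg_left (hi _ (hmem s hs)) (norm_nonneg _)
  · exact hγ.intervalIntegrable_deriv.norm.mul_const C
  · exact ae_of_all _ fun s hs => (hg _ (hmem s hs)).const_smul _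

/-- The difference quotients of a function are locally uniformly bounded. -/
theorem exists_norm_slope_le {f : ℂ → ℂ} {S : Set ℂ} (hS : IsCompact S) (hf : ContinuousOn f S)
    {p f' : ℂ} (hp : HasStrictDerivAt f f' p) :
    ∃ C, ∀ᶠ a in 𝓝 p, ∀ z ∈ S, ‖slope f a z‖ ≤ C := by
  obtain ⟨K, s, hs, hK⟩ := hp.hasStrictFDerivAt.exists_lipschitzOnWith
  obtain ⟨δ, hδ, hball⟩ := Metric.mem_nhds_iff.1 hs
  obtain ⟨B, hB⟩ := hS.exists_bound_of_continuousOn hf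
  have hfa : ∀ᶠ a in 𝓝 p, ‖f a‖ < ‖f p‖ + 1 :=
    hp.hasDerivAt.continuousAt.norm.eventually_lt continuousAt_const (lt_add_one _)
  -- Within δ of p the Lipschitz constant K bounds the quotient. Farther away, a within δ/2 of p
  -- forces |z − a| ≥ δ/2, and the numerator is bounded crudely.
  refine ⟨max K ((B + (‖f p‖ + 1)) * (δ / 2)⁻¹), ?_⟩
  filter_upwards [hfa, Metric.ball_mem_nhds p (half_pos hδ)] with a ha hap z hz
  rw [Metric.mem_ball] at hap
  rw [slope_def_field, norm_div, div_eq_mul_inv]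
  by_cases hzp : z ∈ Metric.ball p δ
  · refine le_max_of_le_left ?_
    have h1 : ‖f z - f a‖ ≤ K * ‖z - a‖ := by
      have := hK.dist_le_mul z (hball hzp) a
        (hball (Metric.mem_ball.2 (hap.trans (half_lt_self hδ))))
      rwa [dist_eq_norm, dist_eq_norm] at this
    rw [← div_eq_mul_inv]
    exact div_le_of_le_mul₀ (norm_nonneg _) K.2 h1
  · refine le_max_of_le_right ?_
    rw [Metric.mem_ball, not_lt] at hzp
    have h1 : δ / 2 ≤ ‖z - a‖ := by
      have := dist_triangle z a p
      rw [← dist_eq_norm]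
      linarith
    have h2 : ‖f z - f a‖ ≤ B + (‖f p‖ + 1) :=
      (norm_sub_le _ _).trans (add_le_add (hB z hz) ha.le)
    exact mul_le_mul h2 (inv_anti₀ (half_pos hδ) h1) (inv_nonneg.2 (norm_nonneg _))
      ((norm_nonneg _).trans h2)

theorem tendsto_slope_left {f : ℂ → ℂ} {p f' : ℂ} (hp : HasDerivAt f f' p) (z : ℂ) :
    Tendsto (fun a => slope f a z) (𝓝[≠] p) (𝓝 (dslope f p z)) := by
  by_cases hz : z = p
  · subst hz
    rw [dslope_same, hp.deriv]
    simp only [slope_comm f _ z]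
    exact hasDerivAt_iff_tendsto_slope.1 hp
  · rw [dslope_of_ne _ hz]
    simp only [slope_def_field]
    have h : ContinuousAt (fun a => (f z - f a) / (z - a)) p :=
      (continuousAt_const.sub hp.continuousAt).div (continuousAt_const.sub continuousAt_id)
        (sub_ne_zero.2 hz)
    exact h.tendsto.mono_left nhdsWithin_le_nhds

/-- The contour integral of the difference quotient of `f` extends continuously across the
contour. -/
theorem exists_tendsto_contourIntegral_slope (hγ : IsClosedPiecewiseC1 γ) {f : ℂ → ℂ}
    (hf : ContinuousOn f (γ '' Icc 0 1)) {p f' : ℂ} (hp : HasStrictDerivAt f f' p)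
    (hpγ : p ∈ γ '' Icc 0 1) :
    ∃ L, Tendsto (fun a => contourIntegral γ (slope f a)) (𝓝[(γ '' Icc 0 1)ᶜ] p) (𝓝 L) := by
  obtain ⟨C, hC⟩ := exists_norm_slope_le hγ.isCompact_image hf hp
  refine ⟨contourIntegral γ (dslope f p), tendsto_contourIntegral hγ (C := C) ?_
    (nhdsWithin_le_nhds hC) fun z _ => (tendsto_slope_left hp.hasDerivAt z).mono_left
      (nhdsWithin_mono p fun a ha h => ha (h ▸ hpγ))⟩
  filter_upwards [self_mem_nhdsWithin] with a ha
  have : ContinuousOn (fun z => (f z - f a) / (z - a)) (γ '' Icc 0 1) :=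
    (hf.sub continuousOn_const).div (continuousOn_id.sub continuousOn_const)
      fun z hz => sub_ne_zero.2 fun h => ha (h ▸ hz)
  exact this.congr fun z _ => slope_def_field f a z

end DifferenceQuotient

section Scalar

theorem mem_resolventSet_complex {w l : ℂ} : l ∈ resolventSet ℂ w ↔ l ≠ w := by
  rw [spectrum.mem_resolventSet_iff, isUnit_iff_ne_zero, Algebra.algebraMap_self, RingHom.id_apply,
    sub_ne_zero]

theorem resolvent_complex (w l : ℂ) : resolvent w l = (l - w)⁻¹ := by
  rw [resolvent, Ring.inverse_eq_inv', Algebra.algebraMap_self, RingHom.id_apply]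

end Scalar

/-! ### Cauchy's formula for a branch of the logarithm -/

namespace LogContour

variable {K : Set ℂ} (c : LogContour K)

theorem zero_notMem_domain : (0 : ℂ) ∉ c.D := fun h => Complex.exp_ne_zero _ (c.exp_log 0 h)

theorem ne_zero_of_mem_domain {z : ℂ} (hz : z ∈ c.D) : z ≠ 0 :=
  fun h => c.zero_notMem_domain (h ▸ hz)

theorem region_subset_domain : c.Ω ⊆ c.D := subset_closure.trans c.closure_subset_domain

theorem isClosedPiecewiseC1 : IsClosedPiecewiseC1 c.γ := c.boundary.curve

theorem image_subset_closure : c.γ '' Icc 0 1 ⊆ closure c.Ω :=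
  c.boundary.image_eq ▸ frontier_subset_closure

theorem image_subset_domain : c.γ '' Icc 0 1 ⊆ c.D :=
  c.image_subset_closure.trans c.closure_subset_domain

theorem notMem_image_of_mem {z : ℂ} (hz : z ∈ c.Ω) : z ∉ c.γ '' Icc 0 1 := by
  rw [c.boundary.image_eq, c.isOpen_region.frontier_eq]
  exact fun h => h.2 hz

theorem notMem_image_of_notMem_closure {z : ℂ} (hz : z ∉ closure c.Ω) : z ∉ c.γ '' Icc 0 1 :=
  fun h => hz (c.image_subset_closure h)

/-- A continuous right inverse of exp is differentiable, with derivative the inverse of exp(log z) =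
z. -/
theorem hasDerivAt_log {z : ℂ} (hz : z ∈ c.D) : HasDerivAt c.log z⁻¹ z := by
  have hnhds := c.isOpen_domain.mem_nhds hz
  have h1 : HasDerivAt Complex.exp z (c.log z) := by
    have := Complex.hasDerivAt_exp (c.log z)
    rwa [c.exp_log z hz] at this
  exact h1.of_local_left_inverse (c.continuousOn_log.continuousAt hnhds)
    (c.ne_zero_of_mem_domain hz) (eventually_of_mem hnhds c.exp_log)

/-- Holomorphy on the open set D gives analyticity, hence strictness, which the Lipschitz bound in
`exists_norm_slope_le` requires. -/
theorem hasStrictDerivAt_log {z : ℂ} (hz : z ∈ c.D) : HasStrictDerivAt c.log (deriv c.log z) z :=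
  (DifferentiableOn.analyticAt
    (fun _ hw => (c.hasDerivAt_log hw).differentiableAt.differentiableWithinAt)
    (c.isOpen_domain.mem_nhds hz)).hasStrictDerivAt

theorem continuousOn_log_image : ContinuousOn c.log (c.γ '' Icc 0 1) :=
  c.continuousOn_log.mono c.image_subset_domain

theorem continuousOn_inv_image : ContinuousOn (fun l : ℂ => l⁻¹) (c.γ '' Icc 0 1) :=
  continuousOn_inv₀.mono fun _ hl => c.ne_zero_of_mem_domain (c.image_subset_domain hl)

theorem contourIntegral_resolvent_of_mem {w : ℂ} (hw : w ∈ c.Ω) :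
    contourIntegral c.γ (resolvent w) = 2 * Real.pi * Complex.I := by
  have h := c.boundary.index_inside w hw
  rw [contourIndex, inv_mul_eq_one₀ Complex.two_pi_I_ne_zero] at h
  rw [h]
  exact congrArg _ (funext fun l => resolvent_complex w l)

theorem contourIntegral_resolvent_of_notMem {w : ℂ} (hw : w ∉ closure c.Ω) :
    contourIntegral c.γ (resolvent w) = 0 := by
  have h := c.boundary.index_outside w hw
  rw [contourIndex, mul_eq_zero_iff_left (inv_ne_zero Complex.two_pi_I_ne_zero)] at h
  rw [← h]
  exact congrArg _ (funext fun l => resolvent_complex w l)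

/-- The exponential omits 0, so 0 is not in D and a fortiori not in the closure of Ω: its index is
0. -/
theorem contourIntegral_inv : contourIntegral c.γ (fun l => l⁻¹) = 0 := by
  rw [← c.contourIntegral_resolvent_of_notMem
    fun h => c.zero_notMem_domain (c.closure_subset_domain h)]
  exact congrArg _ (funext fun l => by rw [resolvent_complex, sub_zero])

section Banach

variable {M : Type*} [NormedRing M] [NormedAlgebra ℂ M] [CompleteSpace M]

/-- By the resolvent identity λ⁻¹R(λ) = A⁻¹R(λ) − λ⁻¹A⁻¹, whose last term integrates to zero. -/
theorem contourIntegral_inv_smul_resolvent {A : M} (hA : IsUnit A)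
    (hu : c.γ '' Icc 0 1 ⊆ resolventSet ℂ A) :
    contourIntegral c.γ (fun l => l⁻¹ • resolvent A l) =
      Ring.inverse A * contourIntegral c.γ (resolvent A) := by
  have hR : ContinuousOn (resolvent A) (c.γ '' Icc 0 1) := fun z hz =>
    (spectrum.hasDerivAt_resolvent_const_left (hu hz)).continuousAt.continuousWithinAt
  have h : ∀ l ∈ c.γ '' Icc 0 1,
      l⁻¹ • resolvent A l = Ring.inverse A * resolvent A l - l⁻¹ • Ring.inverse A := by
    intro l hl
    have hl0 : l ≠ 0 := c.ne_zero_of_mem_domain (c.image_subset_domain hl)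
    have h1 : (l • (1 : M) - A) * resolvent A l = 1 := by
      rw [← Algebra.algebraMap_eq_smul_one]
      exact Ring.mul_inverse_cancel _ (hu hl)
    have h2 : l • resolvent A l = 1 + A * resolvent A l := by
      rw [sub_mul, smul_one_mul] at h1
      rw [← h1, sub_add_cancel]
    have h3 : Ring.inverse A * (l • resolvent A l) = Ring.inverse A + resolvent A l := by
      rw [h2, mul_add, mul_one, ← mul_assoc, Ring.inverse_mul_cancel _ hA, one_mul]
    rw [mul_smul_comm] at h3
    rw [← inv_smul_smul₀ hl0 (Ring.inverse A * resolvent A l), h3, smul_add, add_sub_cancel_left]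
  rw [contourIntegral_congr h, contourIntegral_sub c.isClosedPiecewiseC1
    (continuousOn_const.fun_mul hR) (c.continuousOn_inv_image.fun_smul continuousOn_const),
    contourIntegral_const_mul c.isClosedPiecewiseC1 _ hR, contourIntegral_smul_const,
    c.contourIntegral_inv, zero_smul, sub_zero]

/-- The constant k is left open so that the same computation serves inside the contour (k = 2πi) and
outside it (k = 0). -/
theorem contourIntegral_log_resolvent_sub {A B : M} (hAB : Commute A B) {k : ℂ}
    (hu : ∀ t ∈ Icc (0 : ℝ) 1, ∀ l ∈ c.γ '' Icc 0 1, l ∈ resolventSet ℂ (B + (t : ℂ) • (A - B)))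
    (h0 : ∀ t ∈ Icc (0 : ℝ) 1, IsUnit (B + (t : ℂ) • (A - B)))
    (hk : ∀ t ∈ Icc (0 : ℝ) 1, contourIntegral c.γ (resolvent (B + (t : ℂ) • (A - B))) = k • 1) :
    contourIntegral c.γ (fun l => c.log l • resolvent A l) -
      contourIntegral c.γ (fun l => c.log l • resolvent B l) =
      k • ∫ t in (0 : ℝ)..1, (A - B) * Ring.inverse (B + (t : ℂ) • (A - B)) := by
  rw [contourIntegral_smul_resolvent_sub c.isClosedPiecewiseC1
    (fun z hz => c.hasDerivAt_log (c.image_subset_domain hz)) c.continuousOn_inv_image hAB hu,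
    ← intervalIntegral.integral_smul]
  refine intervalIntegral.integral_congr fun t ht => ?_
  rw [uIcc_of_le zero_le_one] at ht
  simp only [c.contourIntegral_inv_smul_resolvent (h0 t ht) (hu t ht), hk t ht, mul_smul_comm,
    mul_one]

end Banach

theorem _root_.segment_param_mem {S : Set ℂ} {a z : ℂ} (h : segment ℝ a z ⊆ S) {t : ℝ}
    (ht : t ∈ Icc (0 : ℝ) 1) : a + (t : ℂ) • (z - a) ∈ S := by
  refine h ?_
  rw [segment_eq_image']
  exact ⟨t, ht, by simp⟩

/-- `∫_0^1 (z - a) (a + t (z - a))⁻¹ dt = log z - log a`. -/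
theorem intervalIntegral_eq_log_sub_log {a z : ℂ} (h : segment ℝ a z ⊆ c.D) :
    ∫ t in (0 : ℝ)..1, (z - a) * Ring.inverse (a + (t : ℂ) • (z - a)) = c.log z - c.log a := by
  have hline : ∀ t : ℝ, HasDerivAt (fun t : ℝ => a + (t : ℂ) • (z - a)) (z - a) t := fun t => by
    have := ((Complex.ofRealCLM.hasDerivAt (x := t)).smul_const (z - a)).const_add a
    simpa using this
  have hne : ∀ t ∈ Icc (0 : ℝ) 1, a + (t : ℂ) • (z - a) ≠ 0 := fun t ht =>
    c.ne_zero_of_mem_domain (segment_param_mem h ht)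
  simp only [Ring.inverse_eq_inv']
  have := intervalIntegral.integral_eq_sub_of_hasDerivAt
    (f := fun t : ℝ => c.log (a + (t : ℂ) • (z - a))) (a := 0) (b := 1)
    (f' := fun t : ℝ => (z - a) * (a + (t : ℂ) • (z - a))⁻¹) (fun t ht => by
      rw [uIcc_of_le zero_le_one] at ht
      exact (c.hasDerivAt_log (segment_param_mem h ht)).scomp t (hline t))
    (ContinuousOn.intervalIntegrable_of_Icc zero_le_one (continuousOn_const.mul
      (ContinuousOn.inv₀ (by fun_prop) hne)))
  rw [this]
  simp

/-- The Cauchy transform `∫_γ log λ (λ - w)⁻¹ dλ` of the logarithm. -/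
def cauchyLog (w : ℂ) : ℂ := contourIntegral c.γ (fun l => c.log l • resolvent w l)

theorem cauchyLog_sub {a z k : ℂ} (himg : ∀ w ∈ segment ℝ a z, w ∉ c.γ '' Icc 0 1)
    (h0 : (0 : ℂ) ∉ segment ℝ a z)
    (hk : ∀ w ∈ segment ℝ a z, contourIntegral c.γ (resolvent w) = k) :
    c.cauchyLog z - c.cauchyLog a =
      k * ∫ t in (0 : ℝ)..1, (z - a) * Ring.inverse (a + (t : ℂ) • (z - a)) := by
  refine c.contourIntegral_log_resolvent_sub (Commute.all z a) (fun t ht l hl => ?_)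
    (fun t ht => ?_) fun t ht => ?_
  · rw [mem_resolventSet_complex]
    exact fun h => himg _ (segment_param_mem Subset.rfl ht) (h ▸ hl)
  · rw [isUnit_iff_ne_zero]
    exact fun h => h0 (h ▸ segment_param_mem Subset.rfl ht)
  · rw [hk _ (segment_param_mem Subset.rfl ht), smul_eq_mul, mul_one]

theorem cauchyLog_sub_of_segment_subset {a z : ℂ} (h : segment ℝ a z ⊆ c.Ω) :
    c.cauchyLog z - c.cauchyLog a = 2 * Real.pi * Complex.I * (c.log z - c.log a) := by
  rw [← c.intervalIntegral_eq_log_sub_log (h.trans c.region_subset_domain)]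
  exact c.cauchyLog_sub (fun w hw => c.notMem_image_of_mem (h hw))
    (fun h0 => c.zero_notMem_domain (c.region_subset_domain (h h0)))
    fun w hw => c.contourIntegral_resolvent_of_mem (h hw)

/-- Subtracting log a times the index integral compensates the jump of the Cauchy transform across
the contour; the difference quotient on the left has a limit there. -/
theorem contourIntegral_slope_log {a : ℂ} (ha : a ∉ c.γ '' Icc 0 1) :
    contourIntegral c.γ (slope c.log a) =
      c.cauchyLog a - c.log a * contourIntegral c.γ (resolvent a) := by
  have hR : ContinuousOn (resolvent a) (c.γ '' Icc 0 1) := fun z hz =>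
    (spectrum.hasDerivAt_resolvent_const_left (mem_resolventSet_complex.2
      fun h : z = a => ha (h ▸ hz))).continuousAt.continuousWithinAt
  rw [cauchyLog, ← contourIntegral_const_mul c.isClosedPiecewiseC1 _ hR,
    ← contourIntegral_sub c.isClosedPiecewiseC1 (c.continuousOn_log_image.fun_smul hR)
      (continuousOn_const.fun_mul hR)]
  refine congrArg _ (funext fun l => ?_)
  rw [slope_def_field, resolvent_complex, smul_eq_mul, ← sub_mul, div_eq_mul_inv]

/-- On a ball inside Ω the Cauchy transform and 2πi log have equal increments, so the integral is
locally constant; Ω is connected. -/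
theorem contourIntegral_slope_log_eqOn {a z : ℂ} (ha : a ∈ c.Ω) (hz : z ∈ c.Ω) :
    contourIntegral c.γ (slope c.log a) = contourIntegral c.γ (slope c.log z) := by
  refine c.isConnected_region.isPreconnected.induction₂
    (fun a z => contourIntegral c.γ (slope c.log a) = contourIntegral c.γ (slope c.log z))
    (fun x hx => ?_) (fun x y z _ _ _ => Eq.trans) (fun x y _ _ => Eq.symm) ha hz
  obtain ⟨r, hr, hball⟩ := Metric.isOpen_iff.1 c.isOpen_region x hx
  refine nhdsWithin_le_nhds (eventually_of_mem (Metric.ball_mem_nhds x hr) fun y hy => ?_)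
  have h := c.cauchyLog_sub_of_segment_subset
    (((convex_ball x r).segment_subset (Metric.mem_ball_self hr) hy).trans hball)
  rw [c.contourIntegral_slope_log (c.notMem_image_of_mem hx),
    c.contourIntegral_slope_log (c.notMem_image_of_mem (hball hy)),
    c.contourIntegral_resolvent_of_mem hx, c.contourIntegral_resolvent_of_mem (hball hy)]
  linear_combination -h

/-- The Cauchy transform vanishes on a ray to infinity that avoids the closure of the region. -/
theorem cauchyLog_eq_zero_of_ray {w : ℂ} (hw0 : w ≠ 0)
    (hw : ∀ r : ℝ, 1 ≤ r → (r : ℂ) * w ∉ closure c.Ω) : c.cauchyLog w = 0 := by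
  have hseg : ∀ R : ℝ, 1 ≤ R → ∀ z ∈ segment ℝ w (R * w), ∃ r : ℝ, 1 ≤ r ∧ z = r * w := by
    intro R hR z hz
    rw [segment_eq_image'] at hz
    obtain ⟨t, ht, rfl⟩ := hz
    refine ⟨1 + t * (R - 1), by nlinarith [ht.1], ?_⟩
    simp only [Complex.real_smul]
    push_cast
    ring
  have hconst : ∀ R : ℝ, 1 ≤ R → c.cauchyLog (R * w) = c.cauchyLog w := by
    intro R hR
    have h := c.cauchyLog_sub (a := w) (z := R * w) (k := 0)
      (fun z hz => by
        obtain ⟨r, hr, rfl⟩ := hseg R hR z hz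
        exact c.notMem_image_of_notMem_closure (hw r hr))
      (fun h0 => by
        obtain ⟨r, hr, h0⟩ := hseg R hR 0 h0
        have hr0 : (r : ℂ) ≠ 0 := Complex.ofReal_ne_zero.2 (zero_lt_one.trans_le hr).ne'
        exact mul_ne_zero hr0 hw0 h0.symm)
      fun z hz => by
        obtain ⟨r, hr, rfl⟩ := hseg R hR z hz
        exact c.contourIntegral_resolvent_of_notMem (hw r hr)
    rwa [zero_mul, sub_eq_zero] at h
  obtain ⟨B, hB⟩ := c.isClosedPiecewiseC1.isCompact_image.exists_bound_of_continuousOn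
    continuousOn_id
  obtain ⟨C, hC⟩ := c.isClosedPiecewiseC1.isCompact_image.exists_bound_of_continuousOn
    c.continuousOn_log_image
  have hnorm : ∀ (l : ℂ) {R : ℝ}, 0 ≤ R → R * ‖w‖ - ‖l‖ ≤ ‖l - R * w‖ := fun l R hR => by
    have h := norm_sub_norm_le (R * w) l
    rwa [norm_mul, Complex.norm_real, Real.norm_of_nonneg hR, norm_sub_rev] at h
  have hmul : Tendsto (fun R : ℝ => R * ‖w‖) atTop atTop :=
    tendsto_id.atTop_mul_const (norm_pos_iff.2 hw0)
  -- The transform is constant on the ray and tends to 0 at infinity. The condition R‖w‖ ≥ B + 1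
  -- used below keeps the contour at distance at least 1 from Rw.
  have hlim : Tendsto (fun R : ℝ => c.cauchyLog (R * w)) atTop
      (𝓝 (contourIntegral c.γ fun _ => (0 : ℂ))) := by
    refine tendsto_contourIntegral c.isClosedPiecewiseC1 (C := C * 1) ?_ ?_ ?_
    · filter_upwards [eventually_ge_atTop (1 : ℝ)] with R hR
      refine c.continuousOn_log_image.smul fun z hz => ?_
      refine (spectrum.hasDerivAt_resolvent_const_left
        (mem_resolventSet_complex.2 ?_)).continuousAt.continuousWithinAt
      rintro rfl
      exact c.notMem_image_of_notMem_closure (hw R hR) hz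
    · filter_upwards [eventually_ge_atTop (1 : ℝ), hmul.eventually_ge_atTop (B + 1)]
        with R hR hRB z hz
      rw [norm_smul, resolvent_complex, norm_inv]
      have h1 : 1 ≤ ‖z - R * w‖ := by
        have := hnorm z (zero_le_one.trans hR)
        have := hB z hz
        simp only [id] at this
        linarith
      exact mul_le_mul (hC z hz) (inv_le_one_of_one_le₀ h1) (by positivity)
        ((norm_nonneg _).trans (hC z hz))
    · intro z _
      simp only [resolvent_complex]
      rw [← smul_zero (c.log z)]
      refine Tendsto.const_smul ?_ _
      rw [tendsto_zero_iff_norm_tendsto_zero]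
      simp only [norm_inv]
      refine tendsto_inv_atTop_zero.comp (tendsto_atTop_mono' _ ?_
        (tendsto_atTop_add_const_right _ (-‖z‖) hmul))
      filter_upwards [eventually_ge_atTop (0 : ℝ)] with R hR
      exact hnorm z hR
  have h0 : contourIntegral c.γ (fun _ => (0 : ℂ)) = 0 := by simp [contourIntegral]
  rw [h0] at hlim
  refine tendsto_nhds_unique (tendsto_const_nhds.congr' ?_) hlim
  filter_upwards [eventually_ge_atTop (1 : ℝ)] with R hR
  exact (hconst R hR).symm

/-- Cauchy's integral formula for the logarithm. -/
theorem cauchyLog_of_mem {a : ℂ} (ha : a ∈ c.Ω) :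
    c.cauchyLog a = 2 * Real.pi * Complex.I * c.log a := by
  -- A point p of the closure farthest from 0 lies on the contour, and the ray beyond it runs
  -- outside the closure.
  obtain ⟨p, hp, hmax⟩ := c.isBounded_region.isCompact_closure.exists_isMaxOn
    (f := fun z : ℂ => ‖z‖) ⟨a, subset_closure ha⟩ continuous_norm.continuousOn
  have hp0 : p ≠ 0 := c.ne_zero_of_mem_domain (c.closure_subset_domain hp)
  have hout : ∀ r : ℝ, 1 < r → (r : ℂ) * p ∉ closure c.Ω := fun r hr hmem => by
    have h : ‖(r : ℂ) * p‖ ≤ ‖p‖ := hmax hmem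
    rw [norm_mul, Complex.norm_real, Real.norm_of_nonneg (zero_le_one.trans hr.le)] at h
    nlinarith [norm_pos_iff.2 hp0]
  have hray : Tendsto (fun r : ℝ => (r : ℂ) * p) (𝓝[>] 1) (𝓝 p) := by
    have h : ContinuousAt (fun r : ℝ => (r : ℂ) * p) 1 := by fun_prop
    have h2 := h.tendsto.mono_left (nhdsWithin_le_nhds (s := Ioi 1))
    simpa using h2
  have hpγ : p ∈ c.γ '' Icc 0 1 := by
    rw [c.boundary.image_eq, c.isOpen_region.frontier_eq]
    refine ⟨hp, fun hpΩ => ?_⟩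
    obtain ⟨r, hr, hr1⟩ := ((hray.eventually (c.isOpen_region.mem_nhds hpΩ)).and
      self_mem_nhdsWithin).exists
    exact hout r hr1 (subset_closure hr)
  obtain ⟨L, hL⟩ := exists_tendsto_contourIntegral_slope c.isClosedPiecewiseC1
    c.continuousOn_log_image (c.hasStrictDerivAt_log (c.closure_subset_domain hp)) hpγ
  -- Approach p along the outer ray, where both the index and the Cauchy transform vanish.
  have hL0 : L = 0 := by
    have h1 : Tendsto (fun r : ℝ => (r : ℂ) * p) (𝓝[>] 1) (𝓝[(c.γ '' Icc 0 1)ᶜ] p) := by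
      refine tendsto_nhdsWithin_iff.2 ⟨hray, ?_⟩
      filter_upwards [self_mem_nhdsWithin] with r hr
      exact c.notMem_image_of_notMem_closure (hout r hr)
    refine tendsto_nhds_unique (hL.comp h1) (tendsto_const_nhds.congr' ?_)
    filter_upwards [self_mem_nhdsWithin] with r hr
    have hr : 1 < r := hr
    rw [Function.comp_apply,
      c.contourIntegral_slope_log (c.notMem_image_of_notMem_closure (hout r hr)),
      c.contourIntegral_resolvent_of_notMem (hout r hr), mul_zero, sub_zero,
      c.cauchyLog_eq_zero_of_ray
        (mul_ne_zero (Complex.ofReal_ne_zero.2 (zero_lt_one.trans hr).ne') hp0)]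
    intro s hs
    rw [← mul_assoc, ← Complex.ofReal_mul]
    exact hout _ (one_lt_mul_of_le_of_lt hs hr)
  -- Approach p from inside Ω, where the integral is constant.
  have hLa : L = contourIntegral c.γ (slope c.log a) := by
    have := mem_closure_iff_nhdsWithin_neBot.1 hp
    refine tendsto_nhds_unique (hL.mono_left (nhdsWithin_mono p fun z hz =>
      c.notMem_image_of_mem hz)) (tendsto_const_nhds.congr' ?_)
    filter_upwards [self_mem_nhdsWithin] with z hz
    exact c.contourIntegral_slope_log_eqOn ha hz
  rw [hL0, c.contourIntegral_slope_log (c.notMem_image_of_mem ha),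
    c.contourIntegral_resolvent_of_mem ha] at hLa
  linear_combination -hLa

end LogContour

theorem ringInverse_eq_of_mul_eq_one {R : Type*} [Ring R] {a b : R} (h : a * b = 1)
    (h' : b * a = 1) : Ring.inverse a = b :=
  Ring.inverse_unit ⟨a, b, h, h'⟩

/-! ### The logarithm of an element of a C⋆-algebra -/

section ContourLog

variable {M : Type*} [CStarAlgebra M]

/-- The elements of the segment from a point of the convex hull of the spectrum of `A` to `A`
have their spectrum in this convex hull. -/
theorem mem_resolventSet_line {A : M} {a l : ℂ} (ha : a ∈ convexHull ℝ (spectrum ℂ A))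
    (hl : l ∉ convexHull ℝ (spectrum ℂ A)) {t : ℝ} (ht : t ∈ Icc (0 : ℝ) 1) :
    l ∈ resolventSet ℂ (algebraMap ℂ M a + (t : ℂ) • (A - algebraMap ℂ M a)) := by
  rw [spectrum.mem_resolventSet_iff]
  rcases ht.1.eq_or_lt with rfl | ht0
  · have h : l - a ≠ 0 := sub_ne_zero.2 fun h => hl (h ▸ ha)
    simpa [← map_sub] using (isUnit_iff_ne_zero.2 h).map (algebraMap ℂ M)
  have htc : (t : ℂ) ≠ 0 := Complex.ofReal_ne_zero.2 ht0.ne'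
  -- This is the b with l = (1 − t)a + tb; were it spectral, l would lie in the convex hull.
  have hb : (l - (1 - t) * a) / t ∉ spectrum ℂ A := fun hb => hl <| by
    have h := convex_convexHull ℝ (spectrum ℂ A) ha (subset_convexHull ℝ _ hb)
      (sub_nonneg.2 ht.2) ht0.le (sub_add_cancel 1 t)
    convert h using 1
    simp only [Complex.real_smul, Complex.ofReal_sub, Complex.ofReal_one]
    field_simp
    ring
  rw [spectrum.notMem_iff, ← isUnit_smul_iff (Units.mk0 (t : ℂ) htc), Units.smul_mk0] at hb
  convert hb using 1
  have h : l = t * ((l - (1 - t) * a) / t) + (1 - t) * a := by field_simp; ring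
  simp only [Algebra.algebraMap_eq_smul_one]
  conv_lhs => rw [h]
  module

theorem isUnit_line {A : M} (hA : A ∈ analyticDomain M) {a : ℂ}
    (ha : a ∈ convexHull ℝ (spectrum ℂ A)) {t : ℝ} (ht : t ∈ Icc (0 : ℝ) 1) :
    IsUnit (algebraMap ℂ M a + (t : ℂ) • (A - algebraMap ℂ M a)) := by
  have h := mem_resolventSet_line ha hA ht
  rwa [spectrum.mem_resolventSet_iff, map_zero, zero_sub, IsUnit.neg_iff] at h

theorem LogContour.notMem_of_mem_image {K : Set ℂ} (c : LogContour K) {l : ℂ}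
    (hl : l ∈ c.γ '' Icc 0 1) : l ∉ K :=
  fun h => c.notMem_image_of_mem (c.subset_region h) hl

variable {A : M}

theorem mem_analyticDomain_of_logContour
    (c : LogContour (convexHull ℝ (spectrum ℂ A))) : A ∈ analyticDomain M :=
  fun h => c.zero_notMem_domain (c.region_subset_domain (c.subset_region h))

variable (c : LogContour (convexHull ℝ (spectrum ℂ A)))

theorem contourIntegral_smul_resolvent_algebraMap (γ : ℝ → ℂ) (f : ℂ → ℂ) (a : ℂ) :
    contourIntegral γ (fun l => f l • resolvent (algebraMap ℂ M a) l) =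
      contourIntegral γ (fun l => f l • resolvent a l) • (1 : M) := by
  rw [← contourIntegral_smul_const]
  refine congrArg _ (funext fun l => ?_)
  rw [resolvent_complex, resolvent, ← map_sub, smul_assoc, ← Algebra.algebraMap_eq_smul_one]
  congr 1
  by_cases h : l - a = 0
  · simp [h]
  · exact ringInverse_eq_of_mul_eq_one (by rw [← map_mul, mul_inv_cancel₀ h, map_one])
      (by rw [← map_mul, inv_mul_cancel₀ h, map_one])

/-- Contract the element along the segment to the scalar a, where the integral is 2πi times the
index of the contour about a. -/
theorem contourIntegral_resolvent_line {a : ℂ} (ha : a ∈ convexHull ℝ (spectrum ℂ A)) {t : ℝ}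
    (ht : t ∈ Icc (0 : ℝ) 1) :
    contourIntegral c.γ (resolvent (algebraMap ℂ M a + (t : ℂ) • (A - algebraMap ℂ M a))) =
      (2 * Real.pi * Complex.I : ℂ) • (1 : M) := by
  rw [contourIntegral_resolvent_eq c.isClosedPiecewiseC1 (B := algebraMap ℂ M a)
    (Algebra.commute_algebraMap_right _ _) fun s hs l hl => ?_]
  · have h := contourIntegral_smul_resolvent_algebraMap (M := M) c.γ (fun _ => 1) a
    simp only [one_smul] at h
    rw [← c.contourIntegral_resolvent_of_mem (c.subset_region ha)]
    exact h
  -- The point at parameter s between a and the element at parameter t has parameter s * t on the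
  -- full segment.
  · have h := mem_resolventSet_line ha (c.notMem_of_mem_image hl)
      (t := s * t) ⟨mul_nonneg hs.1 ht.1, mul_le_one₀ hs.2 ht.1 ht.2⟩
    rwa [add_sub_cancel_left, smul_smul, ← Complex.ofReal_mul]

/-- The contour integral for `log A` depends on the contour and on the branch of the logarithm only
through the value of the logarithm at one point. -/
theorem contourLog_eq {a : ℂ} (ha : a ∈ convexHull ℝ (spectrum ℂ A)) :
    contourLog A c = c.log a • 1 + ∫ t in (0 : ℝ)..1, (A - algebraMap ℂ M a) *
      Ring.inverse (algebraMap ℂ M a + (t : ℂ) • (A - algebraMap ℂ M a)) := by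
  have h := c.contourIntegral_log_resolvent_sub (A := A) (B := algebraMap ℂ M a)
    (Algebra.commute_algebraMap_right _ _)
    (fun t ht l hl => mem_resolventSet_line ha (c.notMem_of_mem_image hl) ht)
    (fun t ht => isUnit_line (mem_analyticDomain_of_logContour c) ha ht)
    (fun t ht => contourIntegral_resolvent_line c ha ht)
  rw [contourIntegral_smul_resolvent_algebraMap, sub_eq_iff_eq_add'] at h
  have h2 := c.cauchyLog_of_mem (c.subset_region ha)
  rw [LogContour.cauchyLog] at h2
  rw [contourLog, h, h2, smul_add, smul_smul, smul_smul, ← mul_assoc,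
    inv_mul_cancel₀ Complex.two_pi_I_ne_zero, one_mul, one_smul]

/-- With base points a and za in `contourLog_eq` the factor z cancels in the integrand, leaving w =
log′(za) − log a. Keeping B separate from z • A lets z = 1 compare two choices for the same A. -/
theorem exists_contourLog_smul_eq {z : ℂ} (hz : z ≠ 0) {B : M} (hB : B = z • A)
    (c' : LogContour (convexHull ℝ (spectrum ℂ B))) :
    ∃ w : ℂ, Complex.exp w = z ∧ contourLog B c' = contourLog A c + w • 1 := by
  -- In the zero algebra the spectrum is empty and provides no base point.
  rcases subsingleton_or_nontrivial M with hM | hM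
  · exact ⟨Complex.log z, Complex.exp_log hz, Subsingleton.elim _ _⟩
  subst hB
  obtain ⟨a, ha⟩ := spectrum.nonempty A
  have ha' := subset_convexHull ℝ _ ha
  have hza : z * a ∈ spectrum ℂ (z • A) :=
    (spectrum.smul_mem_smul_iff (r := Units.mk0 z hz)).2 ha
  have hza' := subset_convexHull ℝ _ hza
  refine ⟨c'.log (z * a) - c.log a, ?_, ?_⟩
  · rw [Complex.exp_sub, c'.exp_log _ (c'.region_subset_domain (c'.subset_region hza')),
      c.exp_log _ (c.region_subset_domain (c.subset_region ha'))]
    exact mul_div_cancel_right₀ _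
      (c.ne_zero_of_mem_domain (c.region_subset_domain (c.subset_region ha')))
  · rw [contourLog_eq c' hza', contourLog_eq c ha']
    have h : ∀ t ∈ uIcc (0 : ℝ) 1, (z • A - algebraMap ℂ M (z * a)) *
        Ring.inverse (algebraMap ℂ M (z * a) + (t : ℂ) • (z • A - algebraMap ℂ M (z * a))) =
        (A - algebraMap ℂ M a) *
          Ring.inverse (algebraMap ℂ M a + (t : ℂ) • (A - algebraMap ℂ M a)) := by
      intro t ht
      rw [uIcc_of_le zero_le_one] at ht
      have hu := isUnit_line (mem_analyticDomain_of_logContour c) ha' ht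
      have h1 : z • A - algebraMap ℂ M (z * a) = z • (A - algebraMap ℂ M a) := by
        rw [Algebra.algebraMap_eq_smul_one, Algebra.algebraMap_eq_smul_one, smul_sub, mul_smul]
      have h2 : algebraMap ℂ M (z * a) + (t : ℂ) • z • (A - algebraMap ℂ M a) =
          z • (algebraMap ℂ M a + (t : ℂ) • (A - algebraMap ℂ M a)) := by
        rw [Algebra.algebraMap_eq_smul_one, Algebra.algebraMap_eq_smul_one, mul_smul]
        module
      have h3 : Ring.inverse (z • (algebraMap ℂ M a + (t : ℂ) • (A - algebraMap ℂ M a))) =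
          z⁻¹ • Ring.inverse (algebraMap ℂ M a + (t : ℂ) • (A - algebraMap ℂ M a)) :=
        ringInverse_eq_of_mul_eq_one
          (by rw [smul_mul_smul_comm, mul_inv_cancel₀ hz, Ring.mul_inverse_cancel _ hu, one_smul])
          (by rw [smul_mul_smul_comm, inv_mul_cancel₀ hz, Ring.inverse_mul_cancel _ hu, one_smul])
      rw [h1, h2, h3, smul_mul_smul_comm, mul_inv_cancel₀ hz, one_smul]
    rw [intervalIntegral.integral_congr h, sub_smul]
    abel

theorem spectrum_subset_domain : spectrum ℂ A ⊆ c.D :=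
  (subset_convexHull ℝ _).trans (c.subset_region.trans c.region_subset_domain)

/-- For normal elements the contour integral agrees with the continuous functional calculus. -/
theorem contourLog_eq_cfc (hA : IsStarNormal A) : contourLog A c = cfc c.log A := by
  rcases subsingleton_or_nontrivial M with hM | hM
  · exact Subsingleton.elim _ _
  obtain ⟨a, ha⟩ := spectrum.nonempty A
  have hseg : ∀ z ∈ spectrum ℂ A, segment ℝ a z ⊆ convexHull ℝ (spectrum ℂ A) := fun z hz =>
    segment_subset_convexHull ha hz
  have hne : ∀ t ∈ Icc (0 : ℝ) 1, ∀ z ∈ spectrum ℂ A, a + (t : ℂ) * (z - a) ≠ 0 :=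
    fun t ht z hz => c.ne_zero_of_mem_domain (c.region_subset_domain (c.subset_region
      (segment_param_mem (hseg z hz) ht)))
  have hcont : ContinuousOn (Function.uncurry fun (t : ℝ) (z : ℂ) =>
      (z - a) * (a + (t : ℂ) * (z - a))⁻¹) (Icc 0 1 ×ˢ spectrum ℂ A) := by
    refine ContinuousOn.mul (by fun_prop) (ContinuousOn.inv₀ (by fun_prop) ?_)
    exact fun p hp => hne p.1 hp.1 p.2 hp.2
  have hcfc : ∀ t ∈ Ioc (0 : ℝ) 1, cfc (fun z => (z - a) * (a + (t : ℂ) * (z - a))⁻¹) A =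
      (A - algebraMap ℂ M a) *
        Ring.inverse (algebraMap ℂ M a + (t : ℂ) • (A - algebraMap ℂ M a)) := by
    intro t ht
    have hsub : cfc (fun z => z - a) A = A - algebraMap ℂ M a := by
      rw [cfc_sub (fun z => z) (fun _ => a) A, cfc_id' ℂ A, cfc_const a A]
    have hne' := hne t (Ioc_subset_Icc_self ht)
    rw [cfc_mul (fun z => z - a) (fun z => (a + (t : ℂ) * (z - a))⁻¹) A (by fun_prop)
      (ContinuousOn.inv₀ (by fun_prop) hne'), cfc_inv _ A hne',
      cfc_const_add a (fun z => (t : ℂ) * (z - a)) A,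
      cfc_const_mul (t : ℂ) (fun z => z - a) A, hsub]
  obtain ⟨C, hC⟩ := (isCompact_Icc.prod (spectrum.isCompact A)).exists_bound_of_continuousOn hcont
  -- The functional calculus commutes with the t-integral, which reduces `contourLog_eq` to its
  -- scalar version on the spectrum.
  have hint := cfc_setIntegral (μ := volume) (s := Ioc (0 : ℝ) 1) measurableSet_Ioc
    (fun (t : ℝ) (z : ℂ) => (z - a) * (a + (t : ℂ) * (z - a))⁻¹) (fun _ => C) A
    (hcont.mono (prod_mono Ioc_subset_Icc_self Subset.rfl))
    (ae_restrict_of_forall_mem measurableSet_Ioc fun t ht z hz =>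
      hC (t, z) ⟨Ioc_subset_Icc_self ht, hz⟩)
    (integrable_const C).hasFiniteIntegral
  rw [setIntegral_congr_fun measurableSet_Ioc hcfc] at hint
  rw [contourLog_eq c (subset_convexHull ℝ _ ha), intervalIntegral.integral_of_le zero_le_one,
    ← hint]
  have hlog : ∀ z ∈ spectrum ℂ A,
      ∫ t in Ioc (0 : ℝ) 1, (z - a) * (a + (t : ℂ) * (z - a))⁻¹ = c.log z - c.log a := by
    intro z hz
    have h := c.intervalIntegral_eq_log_sub_log ((hseg z hz).trans
      (c.subset_region.trans c.region_subset_domain))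
    simpa only [Ring.inverse_eq_inv', smul_eq_mul, intervalIntegral.integral_of_le zero_le_one]
      using h
  have hlogc : ContinuousOn c.log (spectrum ℂ A) :=
    c.continuousOn_log.mono (spectrum_subset_domain c)
  rw [cfc_congr hlog, cfc_sub c.log (fun _ => c.log a) A, cfc_const (c.log a) A,
    Algebra.algebraMap_eq_smul_one, add_sub_cancel]

end ContourLog

/-! ### Compactness of convex hulls in finite dimension -/

section ConvexHull

variable {E : Type*} [NormedAddCommGroup E] [NormedSpace ℝ E]

theorem isCompact_convexJoin {s t : Set E} (hs : IsCompact s) (ht : IsCompact t) :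
    IsCompact (convexJoin ℝ s t) := by
  have h : convexJoin ℝ s t = (fun p : (E × E) × ℝ => p.1.1 + p.2 • (p.1.2 - p.1.1)) ''
      ((s ×ˢ t) ×ˢ Icc 0 1) := by
    ext x
    simp only [mem_convexJoin, segment_eq_image', mem_image, mem_prod, Prod.exists]
    constructor
    · rintro ⟨a, ha, b, hb, θ, hθ, rfl⟩
      exact ⟨a, b, θ, ⟨⟨ha, hb⟩, hθ⟩, rfl⟩
    · rintro ⟨a, b, θ, ⟨⟨ha, hb⟩, hθ⟩, rfl⟩
      exact ⟨a, ha, b, hb, θ, hθ, rfl⟩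
  rw [h]
  exact ((hs.prod ht).prod isCompact_Icc).image (by fun_prop)

/-- Each join with s allows one more vertex and preserves compactness. -/
theorem exists_isCompact_convexHull_finset_subset {s : Set E} (hs : IsCompact s)
    (hne : s.Nonempty) (n : ℕ) :
    ∃ C ⊆ convexHull ℝ s, IsCompact C ∧ C.Nonempty ∧
      ∀ t : Finset E, (t : Set E) ⊆ s → t.Nonempty → t.card ≤ n + 1 →
        convexHull ℝ (t : Set E) ⊆ C := by
  classical
  induction n with
  | zero =>
    refine ⟨s, subset_convexHull ℝ s, hs, hne, fun t hts ht hcard => ?_⟩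
    obtain ⟨x, rfl⟩ := Finset.card_eq_one.1 (le_antisymm hcard ht.card_pos)
    simpa using hts
  | succ n ih =>
    obtain ⟨C, hCs, hC, hCne, h⟩ := ih
    refine ⟨convexJoin ℝ s C, convexJoin_subset (subset_convexHull ℝ s) hCs
      (convex_convexHull ℝ s), isCompact_convexJoin hs hC, hne.mono (subset_convexJoin_left hCne),
      fun t hts ht hcard => ?_⟩
    obtain ⟨x, hx⟩ := ht
    rw [← Finset.insert_erase hx, Finset.coe_insert]
    rcases (t.erase x).eq_empty_or_nonempty with he | hne'
    · simpa [he] using subset_convexJoin_left hCne (hts hx)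
    · rw [convexHull_insert (by exact_mod_cast hne')]
      refine convexJoin_mono (singleton_subset_iff.2 (hts hx)) (h _ ?_ hne' ?_)
      · exact (Finset.coe_subset.2 (Finset.erase_subset x t)).trans hts
      · rw [Finset.card_erase_of_mem hx]
        omega

/-- In finite dimensions the convex hull of a compact set is compact. -/
theorem isCompact_convexHull_of_finiteDimensional [FiniteDimensional ℝ E] {s : Set E}
    (hs : IsCompact s) : IsCompact (convexHull ℝ s) := by
  rcases s.eq_empty_or_nonempty with rfl | hne
  · simp
  obtain ⟨C, hCs, hC, -, h⟩ :=
    exists_isCompact_convexHull_finset_subset hs hne (Module.finrank ℝ E)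
  have heq : convexHull ℝ s = C := by
    refine subset_antisymm ?_ hCs
    -- Carathéodory: affinely independent finite subsets suffice, and these have at most dim E + 1
    -- points.
    rw [convexHull_eq_union]
    refine iUnion_subset fun t => iUnion₂_subset fun hts hind => ?_
    rcases t.eq_empty_or_nonempty with rfl | ht
    · simp
    · refine h t hts ht ?_
      have h1 := hind.card_le_finrank_succ
      have h2 := Submodule.finrank_le (vectorSpan ℝ (range ((↑) : t → E)))
      rw [Fintype.card_coe] at h1
      omega
  rwa [heq]

end ConvexHull

/-! ### Discs as admissible regions -/

section Disc

/-- The circle with the centre `w` and the radius `r`, parametrised by `[0, 1]`. -/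
def unitCircleMap (w : ℂ) (r : ℝ) (s : ℝ) : ℂ := circleMap w r (2 * Real.pi * s)

theorem contourIntegral_unitCircleMap (w : ℂ) (r : ℝ) (f : ℂ → ℂ) :
    contourIntegral (unitCircleMap w r) f = ∮ z in C(w, r), f z := by
  have h : ∀ s : ℝ, deriv (unitCircleMap w r) s =
      (2 * Real.pi : ℝ) • deriv (circleMap w r) (2 * Real.pi * s) := fun s =>
    deriv_comp_mul_left (2 * Real.pi) (circleMap w r) s
  simp only [contourIntegral, h, circleIntegral, smul_assoc, intervalIntegral.integral_smul]
  have h2 := intervalIntegral.smul_integral_comp_mul_left (a := 0) (b := 1)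
    (fun θ => deriv (circleMap w r) θ • f (circleMap w r θ)) (2 * Real.pi)
  rw [mul_zero, mul_one] at h2
  exact h2

theorem isOrientedBoundary_unitCircleMap (w : ℂ) {r : ℝ} (hr : 0 < r) :
    IsOrientedBoundary (unitCircleMap w r) (Metric.ball w r) where
  curve :=
    { closed := by
        have := periodic_circleMap w r 0
        simpa [unitCircleMap] using this.symm
      piecewise := by
        refine ⟨1, fun i => i, Nat.mono_cast, by simp, by simp, fun i _ => ?_⟩
        exact ((contDiff_circleMap w r).comp (contDiff_const.mul contDiff_id)).contDiffOn }
  image_eq := by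
    rw [frontier_ball w hr.ne']
    refine subset_antisymm ?_ ?_
    · rintro _ ⟨s, -, rfl⟩
      exact circleMap_mem_sphere w hr.le _
    · rw [← abs_of_pos hr, ← image_circleMap_Ioc, abs_of_pos hr]
      rintro _ ⟨θ, hθ, rfl⟩
      refine ⟨θ / (2 * Real.pi), ⟨div_nonneg hθ.1.le Real.two_pi_pos.le,
        (div_le_one Real.two_pi_pos).2 hθ.2⟩, ?_⟩
      rw [unitCircleMap, mul_div_cancel₀ _ Real.two_pi_pos.ne']
  index_inside z hz := by
    rw [contourIndex, contourIntegral_unitCircleMap, circleIntegral.integral_sub_inv_of_mem_ball hz,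
      inv_mul_cancel₀ Complex.two_pi_I_ne_zero]
  index_outside z hz := by
    rw [closure_ball w hr.ne'] at hz
    rw [contourIndex, contourIntegral_unitCircleMap,
      Complex.circleIntegral_eq_zero_of_differentiable_on_off_countable hr.le countable_empty,
      mul_zero]
    · exact ContinuousOn.inv₀ (by fun_prop) fun x hx => sub_ne_zero.2 fun h => hz (h ▸ hx)
    · intro x hx
      refine DifferentiableAt.inv (by fun_prop) (sub_ne_zero.2 fun h => hz (h ▸ ?_))
      exact Metric.ball_subset_closedBall hx.1

theorem Convex.isSimplyConnected {S : Set ℂ} (h : Convex ℝ S) (hne : S.Nonempty) :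
    IsSimplyConnected S := by
  have := h.contractibleSpace hne
  exact SimplyConnectedSpace.ofContractible S

/-- A compact subset of an open half-plane `{z | 0 < Re (v z)}` is contained in a disc whose closure
lies in this half-plane. -/
theorem exists_ball_subset_halfPlane {K : Set ℂ} (hK : IsCompact K) {v : ℂ} (hv : v ≠ 0)
    (hKv : ∀ z ∈ K, 0 < (v * z).re) :
    ∃ (w : ℂ) (r : ℝ), 0 < r ∧ K ⊆ Metric.ball w r ∧
      ∀ z ∈ Metric.closedBall w r, 0 < (v * z).re := by
  -- The disc about R v̄ of radius R|v| touches the boundary line of the half-plane at 0, and z lies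
  -- in it exactly when |z|² < 2R Re(vz).
  have hexp : ∀ (R : ℝ) (z : ℂ), ‖z - R * star v‖ ^ 2 =
      ‖z‖ ^ 2 - 2 * R * (v * z).re + (R * ‖v‖) ^ 2 := by
    intro R z
    rw [mul_pow, ← Complex.normSq_eq_norm_sq, ← Complex.normSq_eq_norm_sq,
      ← Complex.normSq_eq_norm_sq, Complex.normSq_apply, Complex.normSq_apply, Complex.normSq_apply]
    simp
    ring
  have hc : ContinuousOn (fun z : ℂ => ‖z‖ ^ 2 / (v * z).re) K :=
    ContinuousOn.div (by fun_prop) (by fun_prop) fun z hz => (hKv z hz).ne'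
  obtain ⟨C, hC⟩ := hK.exists_bound_of_continuousOn hc
  set R : ℝ := max C 1 with hR
  have hR0 : 0 < R := zero_lt_one.trans_le (le_max_right _ _)
  have hRv : 0 < R * ‖v‖ := mul_pos hR0 (norm_pos_iff.2 hv)
  have hsub : K ⊆ Metric.ball (R * star v) (R * ‖v‖) := by
    intro z hz
    rw [Metric.mem_ball, dist_eq_norm, ← sq_lt_sq₀ (norm_nonneg _) hRv.le, hexp]
    have h1 : ‖z‖ ^ 2 / (v * z).re ≤ R :=
      (le_abs_self _).trans ((hC z hz).trans (le_max_left _ _))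
    rw [div_le_iff₀ (hKv z hz)] at h1
    nlinarith [mul_pos hR0 (hKv z hz)]
  -- Shrinking the radius removes the tangent point 0 from the closed disc.
  obtain ⟨r, hr, hKr⟩ := exists_pos_lt_subset_ball hRv hK.isClosed hsub
  refine ⟨R * star v, r, hr.1, hKr, fun z hz => ?_⟩
  have h1 : ‖z - R * star v‖ ^ 2 < (R * ‖v‖) ^ 2 := by
    rw [sq_lt_sq₀ (norm_nonneg _) hRv.le, ← dist_eq_norm]
    exact (Metric.mem_closedBall.1 hz).trans_lt hr.2
  rw [hexp] at h1
  have h2 : 0 < R * (v * z).re := by nlinarith [sq_nonneg ‖z‖]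
  exact pos_of_mul_pos_right h2 hR0.le

/-- Multiplication by v carries the half-plane into the domain of the principal logarithm, and u
undoes this factor. The branch is recorded explicitly because the polar and positive cases compute
with it. -/
theorem exists_logContour {K : Set ℂ} (hK : IsCompact K) {v : ℂ} (hv : v ≠ 0)
    (hKv : ∀ z ∈ K, 0 < (v * z).re) (u : ℂ) (hu : Complex.exp u = v) :
    ∃ c : LogContour K, c.log = fun z => Complex.log (v * z) - u := by
  obtain ⟨w, r, hr, hKr, hpos⟩ := exists_ball_subset_halfPlane hK hv hKv
  refine ⟨{
    Ω := Metric.ball w r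
    γ := unitCircleMap w r
    D := {z | 0 < (v * z).re}
    log := fun z => Complex.log (v * z) - u
    isOpen_region := Metric.isOpen_ball
    isBounded_region := Metric.isBounded_ball
    isConnected_region := Metric.isConnected_ball hr
    isSimplyConnected_region := (convex_ball w r).isSimplyConnected (Metric.nonempty_ball.2 hr)
    subset_region := hKr
    boundary := isOrientedBoundary_unitCircleMap w hr
    isOpen_domain := isOpen_lt continuous_const (by fun_prop)
    closure_subset_domain := by
      rw [closure_ball w hr.ne']
      exact hpos
    continuousOn_log := by
      refine ContinuousOn.sub (ContinuousOn.clog (by fun_prop) fun z hz => Or.inl hz)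
        continuousOn_const
    exp_log := fun z hz => by
      have hz : 0 < (v * z).re := hz
      have h0 : v * z ≠ 0 := fun h => by simp [h] at hz
      rw [Complex.exp_sub, Complex.exp_log h0, hu, mul_div_cancel_left₀ _ hv] }, rfl⟩

end Disc

/-! ### Half-planes containing the spectrum -/

section Domain

variable {M : Type*} [CStarAlgebra M]

theorem isCompact_convexHull_spectrum (A : M) : IsCompact (convexHull ℝ (spectrum ℂ A)) :=
  isCompact_convexHull_of_finiteDimensional (spectrum.isCompact A)

theorem convexHull_halfPlane {S : Set ℂ} {v : ℂ} (h : ∀ z ∈ S, 0 < (v * z).re) :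
    ∀ z ∈ convexHull ℝ S, 0 < (v * z).re := by
  refine convexHull_min (t := {z | 0 < (v * z).re}) h ?_
  have hl : IsLinearMap ℝ fun z : ℂ => (v * z).re :=
    ⟨fun x y => by simp [mul_add], fun c x => by simp; ring⟩
  exact convex_halfSpace_gt hl 0

theorem mem_analyticDomain_of_halfPlane {A : M} {v : ℂ} (h : ∀ z ∈ spectrum ℂ A, 0 < (v * z).re) :
    A ∈ analyticDomain M := fun h0 => by
  simpa using convexHull_halfPlane h 0 h0

theorem exists_halfPlane {A : M} (hA : A ∈ analyticDomain M) :
    ∃ v : ℂ, v ≠ 0 ∧ ∀ z ∈ spectrum ℂ A, 0 < (v * z).re := by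
  obtain ⟨f, u, hu, hf⟩ := geometric_hahn_banach_point_closed (convex_convexHull ℝ (spectrum ℂ A))
    (isCompact_convexHull_spectrum A).isClosed hA
  rw [map_zero] at hu
  rcases (spectrum ℂ A).eq_empty_or_nonempty with he | ⟨a, ha⟩
  · exact ⟨1, one_ne_zero, by simp [he]⟩
  -- Every real functional on ℂ has the form Re(vz), with v = f(1) − i f(i).
  have hre : ∀ z : ℂ, (((f 1 : ℂ) - f Complex.I * Complex.I) * z).re = f z := by
    intro z
    have h : z = z.re • (1 : ℂ) + z.im • Complex.I := by simp
    conv_rhs => rw [h, map_add, map_smul, map_smul]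
    simp
    ring
  have hpos : ∀ z ∈ spectrum ℂ A, 0 < (((f 1 : ℂ) - f Complex.I * Complex.I) * z).re :=
    fun z hz => by
      rw [hre]
      exact hu.trans (hf z (subset_convexHull ℝ _ hz))
  exact ⟨_, fun h0 => by simpa [h0] using hpos a ha, hpos⟩

end Domain

/-! ### Multi-valued powers and determinants -/

section Values

theorem mem_cpowValues {z s v : ℂ} :
    v ∈ cpowValues z s ↔ ∃ w : ℂ, Complex.exp w = z ∧ v = Complex.exp (s * w) :=
  Iff.rfl

theorem cpowValues_mul {z w : ℂ} (hz : z ≠ 0) (s : ℂ) :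
    cpowValues z s * cpowValues w s = cpowValues (z * w) s := by
  ext v
  simp only [Set.mem_mul, mem_cpowValues]
  constructor
  · rintro ⟨_, ⟨x, hx, rfl⟩, _, ⟨y, hy, rfl⟩, rfl⟩
    exact ⟨x + y, by rw [Complex.exp_add, hx, hy], by rw [mul_add, Complex.exp_add]⟩
  · rintro ⟨x, hx, rfl⟩
    refine ⟨_, ⟨Complex.log z, Complex.exp_log hz, rfl⟩, _, ⟨x - Complex.log z, ?_, rfl⟩, ?_⟩
    · rw [Complex.exp_sub, hx, Complex.exp_log hz, mul_div_cancel_left₀ _ hz]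
    · rw [← Complex.exp_add, mul_sub, add_sub_cancel]

/-- The logarithms of z form a coset of those of 1, so its powers form a coset of the group of
powers of 1. -/
theorem cpowValues_eq_mul_singleton {w z : ℂ} (hw : Complex.exp w = z) (s : ℂ) :
    cpowValues z s = cpowValues 1 s * {Complex.exp (s * w)} := by
  ext v
  simp only [Set.mem_mul, mem_cpowValues, mem_singleton_iff]
  constructor
  · rintro ⟨x, hx, rfl⟩
    refine ⟨_, ⟨x - w, ?_, rfl⟩, _, rfl, ?_⟩
    · rw [Complex.exp_sub, hx, hw, div_self (hw ▸ Complex.exp_ne_zero w)]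
    · rw [← Complex.exp_add, mul_sub, sub_add_cancel]
  · rintro ⟨_, ⟨x, hx, rfl⟩, _, rfl, rfl⟩
    exact ⟨x + w, by rw [Complex.exp_add, hx, hw, one_mul], by rw [mul_add, Complex.exp_add]⟩

theorem cpowValues_one_mul_self (s : ℂ) : cpowValues 1 s * cpowValues 1 s = cpowValues 1 s := by
  rw [cpowValues_mul one_ne_zero, mul_one]

theorem mem_cpowValues_one {s v : ℂ} : v ∈ cpowValues 1 s ↔
    ∃ n : ℤ, v = Complex.exp (2 * Real.pi * Complex.I * n * s) := by
  simp only [mem_cpowValues, Complex.exp_eq_one_iff]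
  constructor
  · rintro ⟨_, ⟨n, rfl⟩, rfl⟩
    exact ⟨n, by ring_nf⟩
  · rintro ⟨n, rfl⟩
    exact ⟨_, ⟨n, rfl⟩, by ring_nf⟩

theorem cpowValues_intCast {z : ℂ} (hz : z ≠ 0) (n : ℤ) : cpowValues z n = {z ^ (n : ℂ)} := by
  ext v
  simp only [mem_cpowValues, mem_singleton_iff, Complex.cpow_intCast]
  constructor
  · rintro ⟨w, rfl, rfl⟩
    exact Complex.exp_int_mul w n
  · rintro rfl
    exact ⟨Complex.log z, Complex.exp_log hz, by rw [Complex.exp_int_mul, Complex.exp_log hz]⟩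

variable {M : Type*} [CStarAlgebra M]

/-- Restriction of the choices for a set to a subset. -/
def LogContour.mono {K K' : Set ℂ} (h : K' ⊆ K) (c : LogContour K) : LogContour K' :=
  { c with subset_region := h.trans c.subset_region }

/-- Passage to another branch of the logarithm. -/
def LogContour.addConst {K : Set ℂ} (c : LogContour K) (w : ℂ) (hw : Complex.exp w = 1) :
    LogContour K :=
  { c with
    log := fun l => c.log l + w
    continuousOn_log := c.continuousOn_log.add continuousOn_const
    exp_log := fun l hl => by rw [Complex.exp_add, hw, mul_one, c.exp_log l hl] }

theorem contourLog_addConst {A : M} (c : LogContour (convexHull ℝ (spectrum ℂ A))) (w : ℂ)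
    (hw : Complex.exp w = 1) : contourLog A (c.addConst w hw) = contourLog A c + w • 1 := by
  rcases subsingleton_or_nontrivial M with hM | hM
  · exact Subsingleton.elim _ _
  obtain ⟨a, ha⟩ := spectrum.nonempty A
  rw [contourLog_eq _ (subset_convexHull ℝ _ ha), contourLog_eq c (subset_convexHull ℝ _ ha)]
  change (c.log a + w) • (1 : M) + _ = _
  rw [add_smul]
  abel

theorem contourDet_eq_mul (τ : M →ₗ[ℂ] ℂ) {A B : M} {c : LogContour (convexHull ℝ (spectrum ℂ A))}
    {c' : LogContour (convexHull ℝ (spectrum ℂ B))} {w : ℂ}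
    (h : contourLog B c' = contourLog A c + w • 1) :
    contourDet τ B c' = Complex.exp (τ 1 * w) * contourDet τ A c := by
  rw [contourDet, contourDet, h, map_add, map_smul, smul_eq_mul, mul_comm w, add_comm,
    Complex.exp_add]

/-- Two choices differ by a logarithm of 1 (`exists_contourLog_smul_eq` with z = 1), and
`LogContour.addConst` realises each such logarithm. -/
theorem detValues_eq_mul_singleton (τ : M →ₗ[ℂ] ℂ) {A : M} {d : ℂ} (hd : d ∈ detValues τ A) :
    detValues τ A = cpowValues 1 (τ 1) * {d} := by
  obtain ⟨c, rfl⟩ := hd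
  ext v
  simp only [Set.mem_mul, mem_cpowValues, mem_singleton_iff]
  constructor
  · rintro ⟨c', rfl⟩
    obtain ⟨w, hw, h⟩ := exists_contourLog_smul_eq c one_ne_zero (one_smul ℂ A).symm c'
    exact ⟨_, ⟨w, hw, rfl⟩, _, rfl, (contourDet_eq_mul τ h).symm⟩
  · rintro ⟨_, ⟨w, hw, rfl⟩, _, rfl, rfl⟩
    exact ⟨c.addConst w hw, contourDet_eq_mul τ (contourLog_addConst c w hw)⟩

theorem nonempty_logContour {A : M} (hA : A ∈ analyticDomain M) :
    Nonempty (LogContour (convexHull ℝ (spectrum ℂ A))) := by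
  obtain ⟨v, hv, h⟩ := exists_halfPlane hA
  obtain ⟨c, -⟩ := exists_logContour (isCompact_convexHull_spectrum A) hv
    (convexHull_halfPlane h) (Complex.log v) (Complex.exp_log hv)
  exact ⟨c⟩

theorem detValues_nonempty (τ : M →ₗ[ℂ] ℂ) {A : M} (hA : A ∈ analyticDomain M) :
    (detValues τ A).Nonempty :=
  have := nonempty_logContour hA
  range_nonempty _

theorem smul_mem_analyticDomain {A : M} (hA : A ∈ analyticDomain M) {z : ℂ} (hz : z ≠ 0) :
    z • A ∈ analyticDomain M := by
  obtain ⟨v, -, h⟩ := exists_halfPlane hA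
  refine mem_analyticDomain_of_halfPlane (v := v * z⁻¹) fun x hx => ?_
  have hx' : z * (z⁻¹ * x) ∈ spectrum ℂ (z • A) := by rwa [mul_inv_cancel_left₀ hz]
  rw [mul_assoc]
  exact h _ ((spectrum.smul_mem_smul_iff (r := Units.mk0 z hz)).1 hx')

theorem detValues_smul (τ : M →ₗ[ℂ] ℂ) {A : M} (hA : A ∈ analyticDomain M) {z : ℂ} (hz : z ≠ 0) :
    detValues τ (z • A) = cpowValues z (τ 1) * detValues τ A := by
  obtain ⟨c⟩ := nonempty_logContour hA
  obtain ⟨c'⟩ := nonempty_logContour (smul_mem_analyticDomain hA hz)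
  obtain ⟨w, hw, h⟩ := exists_contourLog_smul_eq c hz rfl c'
  rw [detValues_eq_mul_singleton τ ⟨c', rfl⟩, detValues_eq_mul_singleton τ ⟨c, rfl⟩,
    contourDet_eq_mul τ h, cpowValues_eq_mul_singleton hw, ← singleton_mul_singleton,
    mul_mul_mul_comm, cpowValues_one_mul_self]

theorem analyticDet_mem (τ : M →ₗ[ℂ] ℂ) {A : M} (hA : A ∈ analyticDomain M) :
    analyticDet τ A ∈ detValues τ A := by
  rw [analyticDet, dif_pos (detValues_nonempty τ hA)]
  exact (detValues_nonempty τ hA).some_mem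

theorem detValues_eq_singleton (τ : M →ₗ[ℂ] ℂ) {A : M} (hA : A ∈ analyticDomain M) {n : ℤ}
    (hn : τ 1 = n) : detValues τ A = {analyticDet τ A} := by
  rw [detValues_eq_mul_singleton τ (analyticDet_mem τ hA), hn, cpowValues_intCast one_ne_zero,
    Complex.one_cpow, singleton_mul_singleton, one_mul]

end Values

/-! ### Normal elements and their polar decomposition -/

section Normal

variable {M : Type*} [CStarAlgebra M] {A : M}

theorem zero_notMem_spectrum (hA : A ∈ analyticDomain M) : (0 : ℂ) ∉ spectrum ℂ A :=
  fun h => hA (subset_convexHull ℝ _ h)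

theorem ne_zero_of_mem_spectrum (hA : A ∈ analyticDomain M) {z : ℂ} (hz : z ∈ spectrum ℂ A) :
    z ≠ 0 :=
  fun h => zero_notMem_spectrum hA (h ▸ hz)

theorem continuousOn_div_norm (hA : A ∈ analyticDomain M) :
    ContinuousOn (fun z : ℂ => z * (‖z‖ : ℂ)⁻¹) (spectrum ℂ A) :=
  continuousOn_id.mul (ContinuousOn.inv₀ (by fun_prop) fun _ hz =>
    Complex.ofReal_ne_zero.2 (norm_ne_zero_iff.2 (ne_zero_of_mem_spectrum hA hz)))

theorem eq_ofReal_norm {z : ℂ} (him : z.im = 0) (hre : 0 ≤ z.re) : z = (‖z‖ : ℂ) := by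
  have h : z = (z.re : ℂ) := Complex.ext rfl (by simp [him])
  rw [h, Complex.norm_real, Real.norm_of_nonneg (by simpa using hre)]

/-- A positive square root of `A⋆A` is the function `|z|` of the normal element `A`. -/
theorem eq_cfc_norm [IsStarNormal A] {P : M} (hP : IsSelfAdjoint P)
    (hPnn : ∀ z ∈ spectrum ℂ P, 0 ≤ z.re) (hsq : P * P = star A * A) :
    P = cfc (fun z : ℂ => (‖z‖ : ℂ)) A := by
  have hPn : IsStarNormal P := hP.isStarNormal
  -- Applying √|z| to P² returns P, and applying it to A⋆A returns |A|; equality of the squares then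
  -- gives P = |A|.
  have hg : Continuous fun z : ℂ => ((Real.sqrt ‖z‖ : ℝ) : ℂ) := by fun_prop
  have h1 : cfc (fun z : ℂ => ((Real.sqrt ‖z‖ : ℝ) : ℂ)) (P * P) = P := by
    have hmul : P * P = cfc (fun z : ℂ => z * z) P := by
      rw [cfc_mul (fun z : ℂ => z) (fun z => z) P, cfc_id' ℂ P]
    rw [hmul, ← cfc_comp' _ (fun z : ℂ => z * z) P hg.continuousOn]
    conv_rhs => rw [← cfc_id' ℂ P]
    refine cfc_congr fun z hz => ?_
    simp only [norm_mul, Real.sqrt_mul_self (norm_nonneg z)]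
    exact (eq_ofReal_norm (hP.im_eq_zero_of_mem_spectrum hz) (hPnn z hz)).symm
  have h2 : cfc (fun z : ℂ => ((Real.sqrt ‖z‖ : ℝ) : ℂ)) (star A * A) =
      cfc (fun z : ℂ => (‖z‖ : ℂ)) A := by
    have hmul : star A * A = cfc (fun z : ℂ => star z * z) A := by
      rw [cfc_mul (fun z : ℂ => star z) (fun z => z) A, cfc_star_id A, cfc_id' ℂ A]
    rw [hmul, ← cfc_comp' _ (fun z : ℂ => star z * z) A hg.continuousOn]
    refine cfc_congr fun z _ => ?_
    simp only [norm_mul, norm_star, Real.sqrt_mul_self (norm_nonneg z)]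
  rw [← h1, hsq, h2]

theorem cfc_div_norm_mul_cfc_norm [IsStarNormal A] (hA : A ∈ analyticDomain M) :
    cfc (fun z : ℂ => z * (‖z‖ : ℂ)⁻¹) A * cfc (fun z : ℂ => (‖z‖ : ℂ)) A = A := by
  rw [← cfc_mul _ _ A (continuousOn_div_norm hA) (Continuous.continuousOn (by fun_prop))]
  conv_rhs => rw [← cfc_id' ℂ A]
  refine cfc_congr fun z hz => ?_
  exact inv_mul_cancel_right₀
    (Complex.ofReal_ne_zero.2 (norm_ne_zero_iff.2 (ne_zero_of_mem_spectrum hA hz))) z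

theorem eq_cfc_div_norm [IsStarNormal A] (hA : A ∈ analyticDomain M) {U : M}
    (h : A = U * cfc (fun z : ℂ => (‖z‖ : ℂ)) A) : U = cfc (fun z : ℂ => z * (‖z‖ : ℂ)⁻¹) A := by
  have hu : IsUnit (cfc (fun z : ℂ => (‖z‖ : ℂ)) A) := by
    rw [isUnit_cfc_iff _ A (Continuous.continuousOn (by fun_prop))]
    exact fun z hz => Complex.ofReal_ne_zero.2
      (norm_ne_zero_iff.2 (ne_zero_of_mem_spectrum hA hz))
  exact hu.mul_right_cancel (h.symm.trans (cfc_div_norm_mul_cfc_norm hA).symm)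

theorem cfc_div_norm_mem_unitary [IsStarNormal A] (hA : A ∈ analyticDomain M) :
    cfc (fun z : ℂ => z * (‖z‖ : ℂ)⁻¹) A ∈ unitary M := by
  refine (cfc_unitary_iff _ A (hf := continuousOn_div_norm hA)).2 fun z hz => ?_
  have hz0 : (‖z‖ : ℂ) ≠ 0 :=
    Complex.ofReal_ne_zero.2 (norm_ne_zero_iff.2 (ne_zero_of_mem_spectrum hA hz))
  have h : star z * z = (‖z‖ : ℂ) ^ 2 := Complex.conj_mul' z
  have hs : star (‖z‖ : ℂ) = (‖z‖ : ℂ) := Complex.conj_ofReal _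
  rw [star_mul', star_inv₀, hs, mul_mul_mul_comm, h]
  field_simp

theorem polar_halfPlane {v z : ℂ} (h : 0 < (v * z).re) : 0 < (v * (z * (‖z‖ : ℂ)⁻¹)).re := by
  have hz : z ≠ 0 := fun h0 => by simp [h0] at h
  rw [← mul_assoc, ← Complex.ofReal_inv, Complex.re_mul_ofReal]
  exact mul_pos h (inv_pos.2 (norm_pos_iff.2 hz))

/-- The determinations of the determinant are multiplicative on the polar decomposition of a normal
element. -/
theorem detValues_polar (τ : M →ₗ[ℂ] ℂ) [IsStarNormal A] (hA : A ∈ analyticDomain M) {U P : M}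
    (hUP : A = U * P) (hP : IsSelfAdjoint P) (hPnn : ∀ z ∈ spectrum ℂ P, 0 ≤ z.re)
    (hsq : P * P = star A * A) :
    U ∈ analyticDomain M ∧ P ∈ analyticDomain M ∧
      detValues τ A = detValues τ U * detValues τ P := by
  obtain rfl := eq_cfc_norm hP hPnn hsq
  obtain rfl := eq_cfc_div_norm hA hUP
  set U := cfc (fun z : ℂ => z * (‖z‖ : ℂ)⁻¹) A with hU
  set P := cfc (fun z : ℂ => (‖z‖ : ℂ)) A with hPdef
  have hUspec : spectrum ℂ U = (fun z : ℂ => z * (‖z‖ : ℂ)⁻¹) '' spectrum ℂ A :=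
    cfc_map_spectrum _ A (hf := continuousOn_div_norm hA)
  have hPspec : spectrum ℂ P = (fun z : ℂ => (‖z‖ : ℂ)) '' spectrum ℂ A :=
    cfc_map_spectrum _ A (hf := Continuous.continuousOn (by fun_prop))
  obtain ⟨v, hv, h⟩ := exists_halfPlane hA
  have hUh : ∀ z ∈ spectrum ℂ U, 0 < (v * z).re := by
    rw [hUspec]
    rintro _ ⟨z, hz, rfl⟩
    exact polar_halfPlane (h z hz)
  have hPh : ∀ z ∈ spectrum ℂ P, 0 < (1 * z).re := by
    rw [hPspec]
    rintro _ ⟨z, hz, rfl⟩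
    simpa using ne_zero_of_mem_spectrum hA hz
  refine ⟨mem_analyticDomain_of_halfPlane hUh, mem_analyticDomain_of_halfPlane hPh, ?_⟩
  -- A single choice covers both σ(A) and σ(U), so A and U share one branch; for P the principal
  -- logarithm is taken.
  obtain ⟨c, hc⟩ := exists_logContour
    (isCompact_convexHull_of_finiteDimensional
      ((spectrum.isCompact A).union (spectrum.isCompact U))) hv
    (convexHull_halfPlane fun z hz => hz.elim (h z) (hUh z)) (Complex.log v) (Complex.exp_log hv)
  obtain ⟨cP, hcP⟩ := exists_logContour (isCompact_convexHull_spectrum P) one_ne_zero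
    (convexHull_halfPlane hPh) 0 Complex.exp_zero
  set cA := c.mono (convexHull_mono (subset_union_left (t := spectrum ℂ U)))
  set cU := c.mono (convexHull_mono (subset_union_right (s := spectrum ℂ A)))
  have hlog : contourLog A cA = contourLog U cU + contourLog P cP := by
    have hUn : IsStarNormal U := cfc_predicate _ A
    have hPn : IsStarNormal P := cfc_predicate _ A
    rw [contourLog_eq_cfc cA inferInstance, contourLog_eq_cfc cU hUn, contourLog_eq_cfc cP hPn]
    have hcU : ContinuousOn c.log ((fun z : ℂ => z * (‖z‖ : ℂ)⁻¹) '' spectrum ℂ A) :=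
      hUspec ▸ c.continuousOn_log.mono (spectrum_subset_domain cU)
    have hcP' : ContinuousOn cP.log ((fun z : ℂ => (‖z‖ : ℂ)) '' spectrum ℂ A) :=
      hPspec ▸ cP.continuousOn_log.mono (spectrum_subset_domain cP)
    have hn : ContinuousOn (fun z : ℂ => (‖z‖ : ℂ)) (spectrum ℂ A) := by fun_prop
    have hU' : cfc cU.log U = cfc (fun z => c.log (z * (‖z‖ : ℂ)⁻¹)) A :=
      (cfc_comp' c.log _ A hcU (continuousOn_div_norm hA)).symm
    have hP' : cfc cP.log P = cfc (fun z : ℂ => cP.log (‖z‖ : ℂ)) A :=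
      (cfc_comp' cP.log _ A hcP' hn).symm
    rw [hU', hP', ← cfc_add A (fun z => c.log (z * (‖z‖ : ℂ)⁻¹)) (fun z => cP.log (‖z‖ : ℂ))
      (hcU.comp (continuousOn_div_norm hA) (mapsTo_image _ _))
      (hcP'.comp hn (mapsTo_image _ _))]
    refine cfc_congr fun z hz => ?_
    change c.log z = c.log (z * (‖z‖ : ℂ)⁻¹) + cP.log (‖z‖ : ℂ)
    have hz0 := ne_zero_of_mem_spectrum hA hz
    have hzn : 0 < ‖z‖ := norm_pos_iff.2 hz0
    have hznc : (‖z‖ : ℂ) ≠ 0 := Complex.ofReal_ne_zero.2 hzn.ne'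
    rw [hc, hcP]
    -- Pulling a positive factor out of the principal logarithm costs no multiple of 2πi.
    have h1 : v * z = (‖z‖ : ℂ) * (v * (z * (‖z‖ : ℂ)⁻¹)) := by field_simp
    simp only [one_mul, sub_zero]
    rw [h1, Complex.log_ofReal_mul hzn (mul_ne_zero hv (mul_ne_zero hz0 (inv_ne_zero hznc))),
      Complex.ofReal_log hzn.le]
    ring
  have hdet : contourDet τ A cA = contourDet τ U cU * contourDet τ P cP := by
    rw [contourDet, hlog, map_add, Complex.exp_add, contourDet, contourDet]
  rw [detValues_eq_mul_singleton τ ⟨cA, rfl⟩, detValues_eq_mul_singleton τ ⟨cU, rfl⟩,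
    detValues_eq_mul_singleton τ ⟨cP, rfl⟩, hdet, mul_mul_mul_comm, cpowValues_one_mul_self,
    singleton_mul_singleton]

end Normal

/-! ### Positive elements and the Fuglede–Kadison determinant -/

section Positive

variable {M : Type*} [CStarAlgebra M] {A : M}

theorem re_pos_of_mem_spectrum (hA : A ∈ analyticDomain M) (hsa : IsSelfAdjoint A)
    (hnn : ∀ z ∈ spectrum ℂ A, 0 ≤ z.re) {z : ℂ} (hz : z ∈ spectrum ℂ A) : 0 < z.re :=
  (hnn z hz).lt_of_ne fun h => ne_zero_of_mem_spectrum hA hz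
    (Complex.ext h.symm (hsa.im_eq_zero_of_mem_spectrum hz))

theorem cfc_sqrt_star_mul_self (hsa : IsSelfAdjoint A) (hnn : ∀ z ∈ spectrum ℂ A, 0 ≤ z.re) :
    cfc Real.sqrt (star A * A) = A := by
  have hn : IsStarNormal A := hsa.isStarNormal
  have hmul : star A * A = cfc (fun z : ℂ => z * z) A := by
    rw [cfc_mul (fun z : ℂ => z) (fun z => z) A, cfc_id' ℂ A, hsa.star_eq]
  rw [cfc_real_eq_complex Real.sqrt (IsSelfAdjoint.star_mul_self A), hmul,
    ← cfc_comp' (fun z : ℂ => ((Real.sqrt z.re : ℝ) : ℂ)) (fun z : ℂ => z * z) A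
      (Continuous.continuousOn (by fun_prop))]
  conv_rhs => rw [← cfc_id' ℂ A]
  refine cfc_congr fun z hz => ?_
  have him := hsa.im_eq_zero_of_mem_spectrum hz
  simp only [Complex.mul_re, him, mul_zero, sub_zero, Real.sqrt_mul_self (hnn z hz)]
  exact Complex.ext rfl (by simp [him])

/-- For a positive element, the Fuglede–Kadison determinant is given by the real logarithm. -/
theorem contourDet_eq_fugledeKadisonDet (τ : M →ₗ[ℂ] ℂ) (hsa : IsSelfAdjoint A)
    (hnn : ∀ z ∈ spectrum ℂ A, 0 ≤ z.re) (c : LogContour (convexHull ℝ (spectrum ℂ A)))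
    (hc : ∀ x ∈ spectrum ℂ A, (c.log x).im = 0) : contourDet τ A c = fugledeKadisonDet τ A := by
  rw [contourDet, fugledeKadisonDet, cfc_sqrt_star_mul_self hsa hnn,
    contourLog_eq_cfc c hsa.isStarNormal, cfc_real_eq_complex Real.log hsa]
  congr 2
  refine cfc_congr fun z hz => ?_
  -- A real number whose exponential is z must be the real logarithm of z.
  have h1 : c.log z = ((c.log z).re : ℂ) := Complex.ext rfl (by simp [hc z hz])
  have h2 := c.exp_log z (spectrum_subset_domain c hz)
  rw [h1, ← Complex.ofReal_exp] at h2
  have h3 : z.re = Real.exp (c.log z).re := by rw [← Complex.ofReal_re (Real.exp _), h2]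
  rw [h3, Real.log_exp, ← h1]

theorem fugledeKadisonDet_mem (τ : M →ₗ[ℂ] ℂ) (hA : A ∈ analyticDomain M) (hsa : IsSelfAdjoint A)
    (hnn : ∀ z ∈ spectrum ℂ A, 0 ≤ z.re) : fugledeKadisonDet τ A ∈ detValues τ A := by
  have hpos : ∀ z ∈ spectrum ℂ A, 0 < (1 * z).re := fun z hz => by
    rw [one_mul]
    exact re_pos_of_mem_spectrum hA hsa hnn hz
  obtain ⟨c, hc⟩ := exists_logContour (isCompact_convexHull_spectrum A) one_ne_zero
    (convexHull_halfPlane hpos) 0 Complex.exp_zero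
  refine ⟨c, contourDet_eq_fugledeKadisonDet τ hsa hnn c fun x hx => ?_⟩
  rw [hc, eq_ofReal_norm (hsa.im_eq_zero_of_mem_spectrum hx) (hnn x hx)]
  simp only [one_mul, sub_zero]
  rw [← Complex.ofReal_log (norm_nonneg x), Complex.ofReal_im]

end Positive

/-! ### Transfer between the von Neumann algebra and B(H) -/

section VonNeumann

variable {H : Type*} [NormedAddCommGroup H] [InnerProductSpace ℂ H] [CompleteSpace H]
  {𝒜 : VonNeumannAlgebra H}

/-- Spectral permanence for closed star subalgebras; it turns positivity in B(H) into a condition on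
the spectrum in 𝒜. -/
theorem VonNeumannAlgebra.spectrum_coe (A : 𝒜) : spectrum ℂ A = spectrum ℂ (A : H →L[ℂ] H) :=
  StarSubalgebra.spectrum_eq 𝒜.toStarSubalgebra (hS := 𝒜.isClosed_coe)

theorem VonNeumannAlgebra.isSelfAdjoint_of_isPositive {A : 𝒜}
    (hA : (A : H →L[ℂ] H).IsPositive) : IsSelfAdjoint A :=
  Subtype.ext hA.isSelfAdjoint

theorem VonNeumannAlgebra.re_nonneg_of_isPositive {A : 𝒜}
    (hA : (A : H →L[ℂ] H).IsPositive) : ∀ z ∈ spectrum ℂ A, 0 ≤ z.re := by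
  intro z hz
  rw [VonNeumannAlgebra.spectrum_coe] at hz
  have h1 := hA.isSelfAdjoint.mem_spectrum_eq_re hz
  rw [h1] at hz
  exact spectrum_nonneg_of_nonneg ((ContinuousLinearMap.nonneg_iff_isPositive _).2 hA)
    ((spectrum.algebraMap_mem_iff ℂ).1 hz)

theorem VonNeumannAlgebra.isPositive_coe_star_mul_self (S : 𝒜) :
    ((star S * S : 𝒜) : H →L[ℂ] H).IsPositive :=
  (ContinuousLinearMap.nonneg_iff_isPositive _).1 (star_mul_self_nonneg (S : H →L[ℂ] H))

theorem VonNeumannAlgebra.exists_isPolarDecomposition {A : 𝒜} [IsStarNormal A]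
    (hA : A ∈ analyticDomain 𝒜) :
    ∃ U P : 𝒜, IsPolarDecomposition (A : H →L[ℂ] H) U P := by
  have hU := cfc_div_norm_mem_unitary hA
  refine ⟨cfc (fun z : ℂ => z * (‖z‖ : ℂ)⁻¹) A, cfc (fun z : ℂ => (‖z‖ : ℂ)) A, ?_, ?_, ?_, ?_⟩
  · exact congrArg Subtype.val (cfc_div_norm_mul_cfc_norm hA).symm
  · exact ⟨congrArg Subtype.val hU.1, congrArg Subtype.val hU.2⟩
  · have hg : ContinuousOn (fun z : ℂ => ((Real.sqrt ‖z‖ : ℝ) : ℂ)) (spectrum ℂ A) :=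
      Continuous.continuousOn (by fun_prop)
    -- Positivity on H is seen from the factorisation |A| = S⋆S with S = √|A|.
    have h : cfc (fun z : ℂ => (‖z‖ : ℂ)) A =
        star (cfc (fun z : ℂ => ((Real.sqrt ‖z‖ : ℝ) : ℂ)) A) *
        cfc (fun z : ℂ => ((Real.sqrt ‖z‖ : ℝ) : ℂ)) A := by
      rw [← cfc_star, ← cfc_mul _ _ A hg.star hg]
      refine cfc_congr fun z _ => ?_
      simp only [Complex.star_def, Complex.conj_ofReal]
      rw [← Complex.ofReal_mul, Real.mul_self_sqrt (norm_nonneg z)]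
    rw [h]
    exact VonNeumannAlgebra.isPositive_coe_star_mul_self _
  · have hg : ContinuousOn (fun z : ℂ => (‖z‖ : ℂ)) (spectrum ℂ A) :=
      Continuous.continuousOn (by fun_prop)
    have h : cfc (fun z : ℂ => (‖z‖ : ℂ)) A * cfc (fun z : ℂ => (‖z‖ : ℂ)) A = star A * A := by
      have hmul : star A * A = cfc (fun z : ℂ => star z * z) A := by
        rw [cfc_mul (fun z : ℂ => star z) (fun z => z) A, cfc_star_id A, cfc_id' ℂ A]
      rw [hmul, ← cfc_mul _ _ A hg hg]
      refine cfc_congr fun z _ => ?_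
      simp only [← sq]
      exact (Complex.conj_mul' z).symm
    exact congrArg Subtype.val h

theorem detValues_isPolarDecomposition (τ : 𝒜 →ₗ[ℂ] ℂ) {A : 𝒜} [IsStarNormal A]
    (hA : A ∈ analyticDomain 𝒜) {U P : 𝒜} (h : IsPolarDecomposition (A : H →L[ℂ] H) U P) :
    U ∈ analyticDomain 𝒜 ∧ P ∈ analyticDomain 𝒜 ∧
      detValues τ A = detValues τ U * detValues τ P :=
  detValues_polar τ hA (Subtype.ext h.eq_mul)
    (VonNeumannAlgebra.isSelfAdjoint_of_isPositive h.positive)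
    (VonNeumannAlgebra.re_nonneg_of_isPositive h.positive) (Subtype.ext h.sq_eq)

end VonNeumann

end

theorem mainTheorem4 {H : Type*} [NormedAddCommGroup H] [InnerProductSpace ℂ H] [CompleteSpace H]
    (𝒜 : VonNeumannAlgebra H) (τ : 𝒜 →ₗ[ℂ] ℂ) (hτ : IsFiniteTrace τ)
    (A : 𝒜) (hA : A ∈ analyticDomain 𝒜) :
    -- the determinations of `det_τ(A)` exist and form one orbit of `exp(2πi τ(I) ℤ)`
    (detValues τ A).Nonempty ∧
    (∀ d ∈ detValues τ A, detValues τ A =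
      {v | ∃ n : ℤ, v = Complex.exp (2 * Real.pi * Complex.I * n * τ 1) * d}) ∧
    -- homogeneity, as an identity of multi-valued expressions
    (∀ z : ℂ, z ≠ 0 → z • A ∈ analyticDomain 𝒜 ∧
      detValues τ (z • A) = cpowValues z (τ 1) * detValues τ A) ∧
    -- polar decomposition, as an identity of multi-valued expressions
    (IsStarNormal A →
      (∃ U P : 𝒜, IsPolarDecomposition (A : H →L[ℂ] H) U P) ∧
      ∀ U P : 𝒜, IsPolarDecomposition (A : H →L[ℂ] H) U P →
        U ∈ analyticDomain 𝒜 ∧ P ∈ analyticDomain 𝒜 ∧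
        detValues τ A = detValues τ U * detValues τ P) ∧
    -- the Fuglede–Kadison determinant is the determination given by the real logarithm
    ((A : H →L[ℂ] H).IsPositive →
      fugledeKadisonDet τ A ∈ detValues τ A ∧
      ∀ c : LogContour (convexHull ℝ (spectrum ℂ A)),
        (∀ x ∈ spectrum ℂ A, (c.log x).im = 0) → contourDet τ A c = fugledeKadisonDet τ A) ∧
    -- if `τ(I)` is an integer, then all expressions are single-valued
    (∀ n : ℤ, τ 1 = n →
      detValues τ A = {analyticDet τ A} ∧
      (∀ z : ℂ, z ≠ 0 → analyticDet τ (z • A) = z ^ (τ 1) * analyticDet τ A) ∧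
      (IsStarNormal A → ∀ U P : 𝒜, IsPolarDecomposition (A : H →L[ℂ] H) U P →
        analyticDet τ A = analyticDet τ U * analyticDet τ P) ∧
      ((A : H →L[ℂ] H).IsPositive → analyticDet τ A = fugledeKadisonDet τ A)) := by
  refine ⟨detValues_nonempty τ hA, fun d hd => ?_, fun z hz =>
    ⟨smul_mem_analyticDomain hA hz, detValues_smul τ hA hz⟩, fun hn =>
    ⟨VonNeumannAlgebra.exists_isPolarDecomposition hA, fun U P h =>
      detValues_isPolarDecomposition τ hA h⟩, fun hpos => ?_, fun n hn => ⟨?_, ?_, ?_, ?_⟩⟩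
  · rw [detValues_eq_mul_singleton τ hd]
    ext v
    simp only [Set.mul_singleton, Set.mem_image, mem_cpowValues_one]
    constructor
    · rintro ⟨_, ⟨m, rfl⟩, rfl⟩
      exact ⟨m, rfl⟩
    · rintro ⟨m, rfl⟩
      exact ⟨_, ⟨m, rfl⟩, rfl⟩
  · have hsa := VonNeumannAlgebra.isSelfAdjoint_of_isPositive hpos
    have hnn := VonNeumannAlgebra.re_nonneg_of_isPositive hpos
    exact ⟨fugledeKadisonDet_mem τ hA hsa hnn,
      fun c hc => contourDet_eq_fugledeKadisonDet τ hsa hnn c hc⟩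
  · exact detValues_eq_singleton τ hA hn
  · intro z hz
    -- With τ(I) an integer every set in this identity is a singleton, so it becomes an equation
    -- between numbers.
    have h := detValues_smul τ hA hz
    rw [detValues_eq_singleton τ hA hn,
      detValues_eq_singleton τ (smul_mem_analyticDomain hA hz) hn, hn, cpowValues_intCast hz,
      Set.singleton_mul_singleton, Set.singleton_eq_singleton_iff] at h
    rw [h, hn]
  · intro _ U P hUP
    obtain ⟨hU, hP, h⟩ := detValues_isPolarDecomposition τ hA hUP
    rwa [detValues_eq_singleton τ hA hn, detValues_eq_singleton τ hU hn,
      detValues_eq_singleton τ hP hn, Set.singleton_mul_singleton,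
      Set.singleton_eq_singleton_iff] at h
  · intro hpos
    have h := fugledeKadisonDet_mem τ hA (VonNeumannAlgebra.isSelfAdjoint_of_isPositive hpos)
      (VonNeumannAlgebra.re_nonneg_of_isPositive hpos)
    rw [detValues_eq_singleton τ hA hn, Set.mem_singleton_iff] at h
    exact h.symm
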